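/- Let $n\ge 1$, let $G$ be the simply connected simple algebraic group over $\mathbb C$ of type $B_n$ with Cartan matrix $a_{ij}=\alpha_j(h_i)$, $a_{n,n-1}=-2$ (so $\alpha_n$ is the short simple root), Chevalley generators $e_i,f_i$, fundamental weights $\Lambda_i$, maximal torus $T$, opposite maximal unipotent subgroups $U^{\pm}$, $x_i(t)=\exp(te_i)$, $y_i(t)=\exp(tf_i)$, and simple coroots $\alpha_i^\vee:\mathbb C^\times\to T$. Put $\overline{s}_i=x_i(-1)y_i(1)x_i(-1)$, and $\overline w=\overline s_{i_1}\cdots\overline s_{i_l}$ for a reduced word $i_1\cdots i_l$ of a Weyl group element $w$. For a dominant weight $\mu$ let $\Delta_\mu$ be the regular function on $G$ with $\Delta_\mu(u^-tu^+)=\mu(t)$ for $u^\pm\in U^\pm$, $t\in T$, and for Weyl group elements $u,v$ put $\Delta_{u\mu,v\mu}(g)=\Delta_\mu(\overline u^{\,-1}g\,\overline v)$. Let $w_0$ be the longest element of the Weyl group, $\mathbf i_0=(1\,2\cdots n)^n$, and for $c=(c^{(1)}_1,c^{(1)}_2,\dots,c^{(1)}_n,c^{(2)}_1,\dots,c^{(n)}_n)\in(\mathbb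 C^\times)^{n^2}$ let $$\Theta^-_{\mathbf i_0}(c)=\prod_{p=1}^{n}\ \prod_{i=1}^{n} y_i\big(c^{(p)}_i\big)\,\alpha_i^\vee\big((c^{(p)}_i)^{-1}\big),$$ the factors being multiplied in the order of the entries of $c$. Then for $1\le k\le n-1$ $$\Delta_{w_0\Lambda_k,s_k\Lambda_k}(\Theta^-_{\mathbf i_0}(c))=c^{(k)}_1+\sum_{j=2}^{n-1}\frac{c^{(k)}_j}{c^{(k+1)}_{j-1}}+\frac{(c^{(k)}_n)^2}{c^{(k+1)}_{n-1}}+2\,\frac{c^{(k)}_n}{c^{(k+1)}_n}+\frac{c^{(k+1)}_{n-1}}{(c^{(k+1)}_n)^2}+\sum_{m=k+2}^{n}\frac{c^{(m)}_{n+k-m}}{c^{(m)}_{n+k-m+1}},$$ and for $k=n$ $$\Delta_{w_0\Lambda_n,s_n\Lambda_n}(\Theta^-_{\mathbf i_0}(c))=c^{(n)}_n .$$ -/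

import Mathlib

namespace TypeB

/-! ### Weights and the Weyl group of type `B_n`

The index set `{1, …, n}` is `Fin n`, the index `i` standing for `i + 1`; the last index is the one
with `i + 1 = n`, and its simple root is the short one. -/

/-- The weight lattice, written in the basis of fundamental weights: `μ i = ⟨h_i, μ⟩`. -/
abbrev Weight (n : ℕ) : Type := Fin n → ℤ

/-- The fundamental weight `Λ_i`. -/
def fundWeight {n : ℕ} (i : Fin n) : Weight n := Pi.single i 1

/-- The simple root `α_i`, whose coordinates are `⟨h_j, α_i⟩`. In `CartanMatrix.B` the entry `(i, j)`
is `⟨α_i, h_j⟩`, so that `⟨h_n, α_{n-1}⟩ = -2`. -/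
def simpleRoot {n : ℕ} (i : Fin n) : Weight n := fun j => CartanMatrix.B n i j

theorem proj_simpleRoot {n : ℕ} (i : Fin n) :
    (LinearMap.proj i : Weight n →ₗ[ℤ] ℤ) (simpleRoot i) = 2 := by
  simp [simpleRoot]

/-- The simple reflection `μ ↦ μ - ⟨h_i, μ⟩ α_i`. -/
def reflectionMap {n : ℕ} (i : Fin n) : Weight n ≃ₗ[ℤ] Weight n :=
  Module.reflection (proj_simpleRoot i)

/-- The Weyl group, generated by the simple reflections. -/
abbrev Weyl (n : ℕ) : Type :=
  Subgroup.closure (Set.range (reflectionMap : Fin n → (Weight n ≃ₗ[ℤ] Weight n)))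

/-- The simple reflection `s_i` as an element of the Weyl group. -/
def simpleRefl {n : ℕ} (i : Fin n) : Weyl n :=
  ⟨reflectionMap i, Subgroup.subset_closure ⟨i, rfl⟩⟩

/-- The length of `w`: the least number of simple reflections with product `w`. -/
noncomputable def weylLength {n : ℕ} (w : Weyl n) : ℕ :=
  sInf {m | ∃ l : List (Fin n), (l.map simpleRefl).prod = w ∧ l.length = m}

/-- `l` is a reduced word of `w`. -/
def IsReducedWord {n : ℕ} (l : List (Fin n)) (w : Weyl n) : Prop :=
  (l.map simpleRefl).prod = w ∧ l.length = weylLength w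

/-- `w` is the longest element of the Weyl group. -/
def IsLongest {n : ℕ} (w : Weyl n) : Prop :=
  ∀ w' : Weyl n, weylLength w' ≤ weylLength w

theorem simpleRefl_inv {n : ℕ} (i : Fin n) : (simpleRefl i)⁻¹ = simpleRefl i := rfl

theorem exists_word {n : ℕ} (w : Weyl n) :
    ∃ l : List (Fin n), (l.map simpleRefl).prod = w := by
  obtain ⟨w, hw⟩ := w
  induction hw using Subgroup.closure_induction with
  | mem x hx =>
    obtain ⟨i, rfl⟩ := hx
    exact ⟨[i], by simp [simpleRefl]⟩
  | one => exact ⟨[], rfl⟩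
  | mul x y hx hy ihx ihy =>
    obtain ⟨l, hl⟩ := ihx
    obtain ⟨m, hm⟩ := ihy
    exact ⟨l ++ m, by simp [hl, hm]⟩
  | inv x hx ih =>
    obtain ⟨l, hl⟩ := ih
    refine ⟨l.reverse, ?_⟩
    have h := congrArg (fun g : Weyl n => g⁻¹) hl
    simp only [List.prod_inv_reverse, List.map_map] at h
    rw [List.map_reverse]
    exact h

theorem exists_reducedWord {n : ℕ} (w : Weyl n) : ∃ l : List (Fin n), IsReducedWord l w :=
  Nat.sInf_mem (s := {m | ∃ l : List (Fin n), (l.map simpleRefl).prod = w ∧ l.length = m})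
    (by obtain ⟨l, hl⟩ := exists_word w; exact ⟨_, l, hl, rfl⟩)

/-! ### The vector and the spin representation of the simple Lie algebra of type `B_n` -/

/-- The basis `v_1, …, v_n`, `v_0`, `v_{\bar 1}, …, v_{\bar n}` of the vector representation. -/
abbrev VecIdx (n : ℕ) : Type := Fin n ⊕ Unit ⊕ Fin n

/-- The basis `(ε_1, …, ε_n)` of the spin representation; `true` is `+` and `false` is `-`. -/
abbrev SpinIdx (n : ℕ) : Type := Fin n → Bool

/-- The matrix of `f_i` on the vector representation: for `i < n`, `f_i v_i = v_{i+1}` and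
`f_i v_{\bar{i+1}} = v_{\bar i}`; moreover `f_n v_n = v_0` and `f_n v_0 = 2 v_{\bar n}`.
The entry at `(a, b)` is the coefficient of `v_a` in `f_i v_b`. -/
def vecF {n : ℕ} (i : Fin n) : Matrix (VecIdx n) (VecIdx n) ℂ :=
  Matrix.of fun a b =>
    match a, b with
    | .inl p, .inl q => if q = i ∧ p.val = i.val + 1 then 1 else 0
    | .inr (.inr p), .inr (.inr q) => if p = i ∧ q.val = i.val + 1 then 1 else 0
    | .inr (.inl _), .inl q => if q = i ∧ i.val + 1 = n then 1 else 0
    | .inr (.inr p), .inr (.inl _) => if p = i ∧ i.val + 1 = n then 2 else 0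
    | _, _ => 0

/-- The matrix of `e_i` on the vector representation: for `i < n`, `e_i v_{i+1} = v_i` and
`e_i v_{\bar i} = v_{\bar{i+1}}`; moreover `e_n v_0 = 2 v_n` and `e_n v_{\bar n} = v_0`. -/
def vecE {n : ℕ} (i : Fin n) : Matrix (VecIdx n) (VecIdx n) ℂ :=
  Matrix.of fun a b =>
    match a, b with
    | .inl p, .inl q => if p = i ∧ q.val = i.val + 1 then 1 else 0
    | .inr (.inr p), .inr (.inr q) => if q = i ∧ p.val = i.val + 1 then 1 else 0
    | .inl p, .inr (.inl _) => if p = i ∧ i.val + 1 = n then 2 else 0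
    | .inr (.inl _), .inr (.inr q) => if q = i ∧ i.val + 1 = n then 1 else 0
    | _, _ => 0

/-- The matrix of `f_i` on the spin representation: for `i < n` it sends `(…, +, -, …)`, with these
signs at the places `i`, `i + 1`, to `(…, -, +, …)`; `f_n` sends `(…, +)` to `(…, -)`; all other
basis vectors are sent to `0`. -/
def spinF {n : ℕ} (i : Fin n) : Matrix (SpinIdx n) (SpinIdx n) ℂ :=
  Matrix.of fun a b =>
    if h : i.val + 1 < n then
      if b i = true ∧ b ⟨i.val + 1, h⟩ = false ∧
          a = Function.update (Function.update b i false) ⟨i.val + 1, h⟩ true then 1 else 0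
    else if b i = true ∧ a = Function.update b i false then 1 else 0

/-- The matrix of `e_i` on the spin representation: for `i < n` it sends `(…, -, +, …)`, with these
signs at the places `i`, `i + 1`, to `(…, +, -, …)`; `e_n` sends `(…, -)` to `(…, +)`; all other
basis vectors are sent to `0`. -/
def spinE {n : ℕ} (i : Fin n) : Matrix (SpinIdx n) (SpinIdx n) ℂ :=
  Matrix.of fun a b =>
    if h : i.val + 1 < n then
      if b i = false ∧ b ⟨i.val + 1, h⟩ = true ∧
          a = Function.update (Function.update b i true) ⟨i.val + 1, h⟩ false then 1 else 0
    else if b i = false ∧ a = Function.update b i true then 1 else 0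

/-! ### The simply connected group of type `B_n`

It is the Chevalley group attached to the faithful representation `V(Λ_1) ⊕ V(Λ_n)`, the sum of the
vector and the spin representation: the subgroup of `GL(V(Λ_1)) × GL(V(Λ_n))` generated by all
`exp(t e_i)` and `exp(t f_i)`. The weights of this representation span the weight lattice, so the
group is the simply connected one, isomorphic to `Spin_{2n+1}(ℂ)`. -/

/-- The exponential of a square matrix, as an invertible matrix. -/
noncomputable def expUnit {m : Type} [Fintype m] [DecidableEq m] (A : Matrix m m ℂ) :
    (Matrix m m ℂ)ˣ where
  val := NormedSpace.exp A
  inv := NormedSpace.exp (-A)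
  val_inv := by
    rw [← Matrix.exp_add_of_commute _ _ (Commute.neg_right (Commute.refl A)), add_neg_cancel,
      NormedSpace.exp_zero]
  inv_val := by
    rw [← Matrix.exp_add_of_commute _ _ (Commute.neg_left (Commute.refl A)), neg_add_cancel,
      NormedSpace.exp_zero]

/-- `GL(V(Λ_1)) × GL(V(Λ_n))`. -/
abbrev Ambient (n : ℕ) : Type :=
  (Matrix (VecIdx n) (VecIdx n) ℂ)ˣ × (Matrix (SpinIdx n) (SpinIdx n) ℂ)ˣ

/-- `exp(t e_i)`. -/
noncomputable def expE {n : ℕ} (i : Fin n) (t : ℂ) : Ambient n :=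
  (expUnit (t • vecE i), expUnit (t • spinE i))

/-- `exp(t f_i)`. -/
noncomputable def expF {n : ℕ} (i : Fin n) (t : ℂ) : Ambient n :=
  (expUnit (t • vecF i), expUnit (t • spinF i))

/-- The simply connected simple algebraic group `G` over `ℂ` of type `B_n`. -/
abbrev G (n : ℕ) : Type :=
  Subgroup.closure {g : Ambient n | ∃ (i : Fin n) (t : ℂ), g = expE i t ∨ g = expF i t}

/-- `x_i(t) = exp(t e_i)`. -/
noncomputable def x {n : ℕ} (i : Fin n) (t : ℂ) : G n :=
  ⟨expE i t, Subgroup.subset_closure ⟨i, t, Or.inl rfl⟩⟩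

/-- `y_i(t) = exp(t f_i)`. -/
noncomputable def y {n : ℕ} (i : Fin n) (t : ℂ) : G n :=
  ⟨expF i t, Subgroup.subset_closure ⟨i, t, Or.inr rfl⟩⟩

/-- The representative `\bar s_i = x_i(-1) y_i(1) x_i(-1)` of the simple reflection `s_i`. -/
noncomputable def sBar {n : ℕ} (i : Fin n) : G n := x i (-1) * y i 1 * x i (-1)

/-- `α_i^∨(c)`, the image of `diag(c, c⁻¹)` under the homomorphism `φ_i : SL_2 → G` that sends the
elementary upper and lower unipotent matrices to `x_i(t)` and `y_i(t)`. In `SL_2`,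
`diag(c, c⁻¹) = X(c) Y(-c⁻¹) X(c) · X(-1) Y(1) X(-1)`. -/
noncomputable def coroot {n : ℕ} (i : Fin n) (c : ℂˣ) : G n :=
  x i (c : ℂ) * y i (-(c : ℂ)⁻¹) * x i (c : ℂ) * sBar i

/-- The maximal torus `T`, parametrized by `a ↦ ∏ α_i^∨(a_i)`; this is an isomorphism
`(ℂ^×)^n ≅ T`, as `G` is simply connected. -/
noncomputable def torus {n : ℕ} (a : Fin n → ℂˣ) : G n :=
  (List.ofFn fun i => coroot i (a i)).prod

/-- The maximal unipotent subgroup `U`, generated by the `x_i(t)`. -/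
def UPlus (n : ℕ) : Subgroup (G n) :=
  Subgroup.closure {g | ∃ (i : Fin n) (t : ℂ), g = x i t}

/-- The maximal unipotent subgroup `U^-`, generated by the `y_i(t)`. -/
def UMinus (n : ℕ) : Subgroup (G n) :=
  Subgroup.closure {g | ∃ (i : Fin n) (t : ℂ), g = y i t}

/-! ### Generalized minors -/

/-- The matrix entries of `g`. -/
def coords {n : ℕ} (g : G n) :
    (VecIdx n × VecIdx n) ⊕ (SpinIdx n × SpinIdx n) → ℂ
  | .inl ab => (g.1.1 : Matrix (VecIdx n) (VecIdx n) ℂ) ab.1 ab.2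
  | .inr ab => (g.1.2 : Matrix (SpinIdx n) (SpinIdx n) ℂ) ab.1 ab.2

/-- Regular functions on `G`: the polynomials in the matrix entries (all of `G` has determinant
`1` on both summands). -/
def IsRegular {n : ℕ} (F : G n → ℂ) : Prop :=
  ∃ p : MvPolynomial ((VecIdx n × VecIdx n) ⊕ (SpinIdx n × SpinIdx n)) ℂ,
    ∀ g : G n, F g = MvPolynomial.eval (coords g) p

/-- `F` is the principal minor `Δ_μ`: the regular function on `G` with `F(u⁻ t u⁺) = μ(t)` for
`u⁻ ∈ U⁻`, `t ∈ T`, `u⁺ ∈ U`, where `μ(∏ α_i^∨(a_i)) = ∏ a_i ^ ⟨h_i, μ⟩`. It is determined by these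
values, as `U⁻ T U` is dense in `G`. -/
def IsPrincipalMinor {n : ℕ} (μ : Weight n) (F : G n → ℂ) : Prop :=
  IsRegular F ∧ ∀ u ∈ UMinus n, ∀ a : Fin n → ℂˣ, ∀ v ∈ UPlus n,
    F (u * torus a * v) = ∏ i, (a i : ℂ) ^ μ i

open Classical in
/-- The principal minor `Δ_μ`, for `μ` dominant. -/
noncomputable def principalMinor {n : ℕ} (μ : Weight n) : G n → ℂ :=
  if h : ∃ F : G n → ℂ, IsPrincipalMinor μ F then h.choose else 0

/-- The representative `\bar w = \bar s_{i_1} ⋯ \bar s_{i_l}` of `w` in the group, for a reduced word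
`i_1 ⋯ i_l` of `w`. -/
noncomputable def weylLift {n : ℕ} (w : Weyl n) : G n :=
  ((exists_reducedWord w).choose.map sBar).prod

/-- The generalized minor `Δ_{uμ, vμ}(g) = Δ_μ(\bar u⁻¹ g \bar v)`. -/
noncomputable def genMinor {n : ℕ} (μ : Weight n) (u v : Weyl n) (g : G n) : ℂ :=
  principalMinor μ ((weylLift u)⁻¹ * g * weylLift v)

/-! ### The map `Θ⁻` -/

/-- The boldface `y_i(c) α_i^∨(c⁻¹)`. -/
noncomputable def yBold {n : ℕ} (i : Fin n) (c : ℂˣ) : G n := y i (c : ℂ) * coroot i c⁻¹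

/-- `Θ⁻_{i_1 ⋯ i_N}(c_1, …, c_N) = yBold i_1 c_1 ⋯ yBold i_N c_N`, the letters of the word being
listed together with their parameters. -/
noncomputable def thetaMinus {n : ℕ} (l : List (Fin n × ℂˣ)) : G n :=
  (l.map fun ic => yBold ic.1 ic.2).prod

/-- The word `(1 2 ⋯ n)^n` with the parameters
`c_1^{(1)}, c_2^{(1)}, …, c_n^{(1)}, c_1^{(2)}, …, c_n^{(n)}` at its letters; `c p i` is `c_i^{(p)}`,
both indices running from `1` to `n`. -/
def wordZero (n : ℕ) (c : ℕ → ℕ → ℂˣ) : List (Fin n × ℂˣ) :=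
  (List.ofFn fun p : Fin n =>
    List.ofFn fun i : Fin n => (i, c (p.val + 1) (i.val + 1))).flatten

end TypeB

/-!
By density of the big cell `U⁻ T U`, a regular function that is invariant under `U⁻` on the left
and under `U` on the right is the principal minor of the character by which `T` acts. This
identifies `Δ_{Λ_k}`, for `k < n`, with the leading `k × k` minor of the vector representation, and
`Δ_{Λ_n}` with the highest weight matrix coefficient of the spin representation. Translation by
`\bar w₀` replaces the rows by those of the lowest weights, up to signs, and translation by
`\bar s_k` permutes the columns. Now `Θ⁻` is the product of the `n` factors
`∏_i y_i(c_i) α_i^∨(c_i⁻¹)`.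

For `k < n`, consider the entries of `Θ⁻` in the rows `v_{\bar 1}, …, v_{\bar k}` and in the
columns `v_1, …, v_{k-1}, v_{k+1}`. Operations between adjacent rows strip off the first factor
from all rows but the last one, up to scalars, and clear the first column except for its last
entry. Expanding along this column, one loses a row, a column and a factor of `Θ⁻`; after `k - 1`
steps the determinant is the entry at `(v_{\bar 1}, v_{k+1})` of the product of the last
`n - k + 1` factors, which is a sum over paths in the basis of the vector representation. The
formulas for a factor are uniform under the convention `c_0 = 1`.

For `k = n`, the vector `\bar s_n v_{Λ_n}` of the spin representation has one minus sign, and the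
last factor multiplies it by `c_n` and keeps this number. Every other factor raises the number of
minus signs by at most one, so all of them must do so in order to reach the lowest weight vector,
and there is just one way, with coefficient one.
-/

namespace TypeB

open Matrix

/-! ### Matrices -/

theorem ext_mulVec {R l m : Type*} [NonAssocSemiring R] [Fintype m] {A B : Matrix l m R}
    (h : ∀ f a, (A *ᵥ f) a = (B *ᵥ f) a) : A = B :=
  Matrix.mulVec_injective (funext fun f => funext (h f))

theorem of_mulVec_apply {R l m : Type*} [NonUnitalNonAssocSemiring R] [Fintype m] (A : l → m → R)
    (f : m → R) (s : l) : (Matrix.of A *ᵥ f) s = A s ⬝ᵥ f :=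
  rfl

theorem det_eq_of_forall_row_eq_smul_sub_succ {R : Type*} [CommRing R] {s : ℕ}
    {T : Matrix (Fin (s + 1)) (Fin (s + 1)) R} (B : Matrix (Fin s) (Fin (s + 1)) R) (u : Fin s → R)
    (hT : ∀ p q, T p.castSucc q = u p * (B p q - T p.succ q)) (hB : ∀ p, B p 0 = 0) :
    T.det = (-1) ^ s * T (Fin.last s) 0 * ((∏ p, u p) * (B.submatrix id Fin.succ).det) := by
  set A : Matrix (Fin (s + 1)) (Fin (s + 1)) R :=
    of (Fin.snoc (fun p q => u p * B p q) (T (Fin.last s))) with hA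
  have hTA : T.det = A.det := by
    rw [← Matrix.det_submatrix_equiv_self Fin.revPerm T,
      ← Matrix.det_submatrix_equiv_self Fin.revPerm A]
    refine Matrix.det_eq_of_forall_row_eq_smul_add_pred (fun p => -u p.rev) (fun q => ?_)
      fun p q => ?_
    · simp [hA]
    · simp only [Matrix.submatrix_apply, Fin.revPerm_apply, Fin.rev_succ, Fin.rev_castSucc, hT, hA,
        of_apply, Fin.snoc_castSucc]
      ring
  have hA0 (p : Fin s) : A p.castSucc 0 = 0 := by simp [hA, hB]
  have hAsub : A.submatrix Fin.castSucc Fin.succ =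
      of fun p q => u p * B.submatrix id Fin.succ p q := by
    ext p q
    simp [hA]
  have hAlast : A (Fin.last s) 0 = T (Fin.last s) 0 := by simp [hA]
  rw [hTA, Matrix.det_succ_column_zero, Fin.sum_univ_castSucc, Fin.succAbove_last, hAsub,
    Matrix.det_mul_column, hAlast]
  simp [hA0]

/-! ### Representations of `2 × 2` matrices -/

section RankOne

variable {R m : Type*} [CommRing R] [Fintype m] [DecidableEq m]

/-- The matrix by which `M` acts in `stringRep`. -/
def stringMatrix (κ : m → ℤ) (τ : m → m) (M : Matrix (Fin 2) (Fin 2) R) : Matrix m m R :=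
  Matrix.of fun s =>
    if κ s = 1 then M 0 0 • Pi.single s 1 + M 0 1 • Pi.single (τ s) 1
    else if κ s = -1 then M 1 0 • Pi.single (τ s) 1 + M 1 1 • Pi.single s 1
    else Pi.single s 1

theorem stringMatrix_mulVec (κ : m → ℤ) (τ : m → m) (M : Matrix (Fin 2) (Fin 2) R) (f : m → R)
    (s : m) :
    (stringMatrix κ τ M *ᵥ f) s =
      if κ s = 1 then M 0 0 * f s + M 0 1 * f (τ s)
      else if κ s = -1 then M 1 0 * f (τ s) + M 1 1 * f s
      else f s := by
  rw [stringMatrix, of_mulVec_apply]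
  split_ifs <;> simp

/-- The representation of `2 × 2` matrices on `m → R` built from the two-dimensional strings
`{s, τ s}` with `κ s = 1`, on which it is the standard representation; the coordinates `s` with
`κ s ≠ ±1` are fixed. -/
def stringRep (κ : m → ℤ) (τ : m → m) (hτ : Function.Involutive τ)
    (hκ : ∀ s, κ (τ s) = -κ s) : Matrix (Fin 2) (Fin 2) R →* Matrix m m R where
  toFun := stringMatrix κ τ
  map_one' := ext_mulVec fun f s => by simp [stringMatrix_mulVec]
  map_mul' M N := ext_mulVec fun f s => by
    rw [← Matrix.mulVec_mulVec]
    simp only [stringMatrix_mulVec, hτ s, hκ, Matrix.mul_apply, Fin.sum_univ_two]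
    by_cases h1 : κ s = 1
    · simp [h1]; ring
    by_cases h2 : κ s = -1
    · simp [h2]; ring
    · simp [h1, h2]

/-- The matrix by which `M` acts in `symSqRep`. -/
def symSqMatrix (p z q : m) (M : Matrix (Fin 2) (Fin 2) R) : Matrix m m R :=
  Matrix.of fun s =>
    if s = p then M 0 0 ^ 2 • Pi.single p 1 + (2 * M 0 0 * M 0 1) • Pi.single z 1
      + M 0 1 ^ 2 • Pi.single q 1
    else if s = z then (M 0 0 * M 1 0) • Pi.single p 1
      + (M 0 0 * M 1 1 + M 0 1 * M 1 0) • Pi.single z 1 + (M 0 1 * M 1 1) • Pi.single q 1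
    else if s = q then M 1 0 ^ 2 • Pi.single p 1 + (2 * M 1 0 * M 1 1) • Pi.single z 1
      + M 1 1 ^ 2 • Pi.single q 1
    else Pi.single s 1

theorem symSqMatrix_mulVec (p z q : m) (M : Matrix (Fin 2) (Fin 2) R) (f : m → R) (s : m) :
    (symSqMatrix p z q M *ᵥ f) s =
      if s = p then M 0 0 ^ 2 * f p + 2 * M 0 0 * M 0 1 * f z + M 0 1 ^ 2 * f q
      else if s = z then
        M 0 0 * M 1 0 * f p + (M 0 0 * M 1 1 + M 0 1 * M 1 0) * f z + M 0 1 * M 1 1 * f q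
      else if s = q then M 1 0 ^ 2 * f p + 2 * M 1 0 * M 1 1 * f z + M 1 1 ^ 2 * f q
      else f s := by
  rw [symSqMatrix, of_mulVec_apply]
  split_ifs <;> simp

/-- The symmetric square of the standard representation of `2 × 2` matrices, placed on three
coordinates `p, z, q`; the other coordinates are fixed. -/
def symSqRep {p z q : m} (hpz : p ≠ z) (hpq : p ≠ q) (hzq : z ≠ q) :
    Matrix (Fin 2) (Fin 2) R →* Matrix m m R where
  toFun := symSqMatrix p z q
  map_one' := ext_mulVec fun f s => by
    simp only [symSqMatrix_mulVec, Matrix.one_apply, Matrix.one_mulVec]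
    split_ifs <;> simp_all
  map_mul' M N := ext_mulVec fun f s => by
    rw [← Matrix.mulVec_mulVec]
    simp only [symSqMatrix_mulVec, Matrix.mul_apply, Fin.sum_univ_two, if_pos, if_neg hpz.symm,
      if_neg hpq.symm, if_neg hzq.symm]
    split_ifs <;> ring

end RankOne

/-! ### Exponentials of nilpotent matrices -/

theorem exp_smul_eq_sum_of_pow_eq_zero {A : Type*} [Ring A] [Algebra ℂ A] [TopologicalSpace A]
    [IsTopologicalRing A] {a : A} {k : ℕ} (ha : a ^ k = 0) (t : ℂ) :
    NormedSpace.exp (t • a) = ∑ j ∈ Finset.range k, (t ^ j / j.factorial) • a ^ j := by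
  rw [congrFun (NormedSpace.exp_eq_tsum ℂ) (t • a), tsum_eq_sum (s := Finset.range k)]
  · refine Finset.sum_congr rfl fun j _ => ?_
    rw [smul_pow, smul_smul, div_eq_inv_mul]
  · intro j hj
    rw [smul_pow, pow_eq_zero_of_le (by simpa using hj) ha, smul_zero, smul_zero]

section Exp

variable {m : Type*} [Fintype m] [DecidableEq m]

theorem mulVec_of_apply_eq_ite {κ : m → ℤ} {k : ℤ} {τ : m → m} {E : Matrix m m ℂ}
    (hE : ∀ a b, E a b = if κ a = k ∧ b = τ a then 1 else 0) (f : m → ℂ) (s : m) :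
    (E *ᵥ f) s = if κ s = k then f (τ s) else 0 := by
  simp [Matrix.mulVec, dotProduct, hE, ite_and]

theorem exp_smul_eq_stringMatrix_upper {κ : m → ℤ} {τ : m → m} (hκ : ∀ s, κ (τ s) = -κ s)
    {E : Matrix m m ℂ} (hE : ∀ a b, E a b = if κ a = 1 ∧ b = τ a then 1 else 0) (t : ℂ) :
    NormedSpace.exp (t • E) = stringMatrix κ τ !![1, t; 0, 1] := by
  have hEf := mulVec_of_apply_eq_ite hE
  have hsq : E ^ 2 = 0 := ext_mulVec fun f s => by
    rw [pow_two, ← Matrix.mulVec_mulVec]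
    simp +contextual [hEf, hκ]
  rw [exp_smul_eq_sum_of_pow_eq_zero hsq]
  refine ext_mulVec fun f s => ?_
  simp only [Finset.sum_range_succ, Finset.sum_range_zero, zero_add, pow_zero, pow_one,
    Nat.factorial, Nat.cast_one, div_one, mul_one, one_smul, Matrix.add_mulVec, Matrix.one_mulVec,
    Matrix.smul_mulVec, Pi.add_apply, Pi.smul_apply, hEf, stringMatrix_mulVec]
  by_cases h1 : κ s = 1 <;> simp [h1]

theorem exp_smul_eq_stringMatrix_lower {κ : m → ℤ} {τ : m → m} (hκ : ∀ s, κ (τ s) = -κ s)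
    {F : Matrix m m ℂ} (hF : ∀ a b, F a b = if κ a = -1 ∧ b = τ a then 1 else 0) (t : ℂ) :
    NormedSpace.exp (t • F) = stringMatrix κ τ !![1, 0; t, 1] := by
  rw [exp_smul_eq_stringMatrix_upper (κ := -κ) (τ := τ) (by simp [hκ])
    (by simpa [neg_eq_iff_eq_neg] using hF)]
  refine ext_mulVec fun f s => ?_
  simp only [stringMatrix_mulVec, Pi.neg_apply, neg_eq_iff_eq_neg, neg_neg]
  by_cases h1 : κ s = 1
  · simp [h1]
  by_cases h2 : κ s = -1
  · simp [h2, add_comm]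
  · simp [h1, h2]

theorem exp_smul_eq_symSqMatrix_upper {p z q : m} (hpz : p ≠ z) (hpq : p ≠ q) (hzq : z ≠ q)
    {E : Matrix m m ℂ}
    (hE : ∀ a b, E a b = if a = p ∧ b = z then 2 else if a = z ∧ b = q then 1 else 0) (t : ℂ) :
    NormedSpace.exp (t • E) = symSqMatrix p z q !![1, t; 0, 1] := by
  have hEf (f : m → ℂ) (s : m) :
      (E *ᵥ f) s = if s = p then 2 * f z else if s = z then f q else 0 := by
    simp only [Matrix.mulVec, dotProduct, hE]
    split_ifs <;> simp_all
  have hcube : E ^ 3 = 0 := ext_mulVec fun f s => by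
    simp only [pow_three, ← Matrix.mulVec_mulVec, hEf]
    simp [hpz.symm, hpq.symm, hzq.symm]
  rw [exp_smul_eq_sum_of_pow_eq_zero hcube]
  refine ext_mulVec fun f s => ?_
  simp only [Finset.sum_range_succ, Finset.sum_range_zero, zero_add, pow_zero, pow_one, pow_two,
    Matrix.add_mulVec, Matrix.one_mulVec, Matrix.smul_mulVec, Pi.add_apply, Pi.smul_apply,
    ← Matrix.mulVec_mulVec, hEf, symSqMatrix_mulVec]
  split_ifs <;> simp_all
  ring

theorem exp_smul_eq_symSqMatrix_lower {p z q : m} (hpz : p ≠ z) (hpq : p ≠ q) (hzq : z ≠ q)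
    {F : Matrix m m ℂ}
    (hF : ∀ a b, F a b = if a = q ∧ b = z then 2 else if a = z ∧ b = p then 1 else 0) (t : ℂ) :
    NormedSpace.exp (t • F) = symSqMatrix p z q !![1, 0; t, 1] := by
  rw [exp_smul_eq_symSqMatrix_upper hzq.symm hpq.symm hpz.symm hF]
  refine ext_mulVec fun f s => ?_
  simp only [symSqMatrix_mulVec]
  split_ifs <;> simp_all <;> ring

end Exp

/-! ### Weights of the vector and the spin representation -/

section Weights

variable {n : ℕ}

theorem succ_lt_or_succ_eq (i : Fin n) : i.val + 1 < n ∨ i.val + 1 = n :=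
  lt_or_eq_of_le i.isLt

/-- The weight `ε_p` of the basis vector `v_p` of the vector representation; in terms of the
fundamental weights, `ε_p = Λ_p - Λ_{p-1}` for `p < n` and `ε_n = 2 Λ_n - Λ_{n-1}`. -/
def eps (p : Fin n) : Weight n := fun i =>
  if i = p then if i.val + 1 = n then 2 else 1 else if i.val + 1 = p.val then -1 else 0

theorem simpleRoot_of_lt {i : Fin n} (h : i.val + 1 < n) :
    simpleRoot i = eps i - eps ⟨i.val + 1, h⟩ := by
  funext j
  simp only [simpleRoot, CartanMatrix.B, Matrix.of_apply, eps, Pi.sub_apply, Fin.ext_iff]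
  split_ifs <;> omega

theorem simpleRoot_of_last {i : Fin n} (h : i.val + 1 = n) : simpleRoot i = eps i := by
  funext j
  simp only [simpleRoot, CartanMatrix.B, Matrix.of_apply, eps, Fin.ext_iff]
  split_ifs <;> omega

theorem reflectionMap_apply (i : Fin n) (μ : Weight n) :
    reflectionMap i μ = μ - μ i • simpleRoot i := by
  rw [reflectionMap, Module.reflection_apply, LinearMap.proj_apply]

theorem reflectionMap_eps_of_lt {i : Fin n} (h : i.val + 1 < n) (p : Fin n) :
    reflectionMap i (eps p) = eps (Equiv.swap i ⟨i.val + 1, h⟩ p) := by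
  rw [reflectionMap_apply, simpleRoot_of_lt h]
  have hi : eps p i = if p = i then 1 else if p = ⟨i.val + 1, h⟩ then -1 else 0 := by
    simp only [eps, Fin.ext_iff]
    split_ifs <;> omega
  rw [hi, Equiv.swap_apply_def]
  split_ifs <;> simp_all

theorem reflectionMap_eps_of_last {i : Fin n} (h : i.val + 1 = n) (p : Fin n) :
    reflectionMap i (eps p) = if p = i then -eps p else eps p := by
  rw [reflectionMap_apply, simpleRoot_of_last h]
  have hi : eps p i = if p = i then 2 else 0 := by
    simp only [eps, Fin.ext_iff]
    split_ifs <;> omega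
  rw [hi]
  split_ifs with hp
  · rw [hp]
    module
  · simp

/-- The weights of the basis vectors of the vector representation. -/
def vecWt : VecIdx n → Weight n
  | .inl p => eps p
  | .inr (.inl _) => 0
  | .inr (.inr p) => -eps p

/-- The action of the simple reflection `s_i` on the basis of the vector representation, by which
the weights are permuted. -/
def reflVec (i : Fin n) : Equiv.Perm (VecIdx n) :=
  if h : i.val + 1 < n then
    Equiv.sumCongr (Equiv.swap i ⟨i.val + 1, h⟩)
      (Equiv.sumCongr (Equiv.refl Unit) (Equiv.swap i ⟨i.val + 1, h⟩))
  else Equiv.swap (.inl i) (.inr (.inr i))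

theorem reflVec_of_lt {i : Fin n} (h : i.val + 1 < n) :
    reflVec i = Equiv.sumCongr (Equiv.swap i ⟨i.val + 1, h⟩)
      (Equiv.sumCongr (Equiv.refl Unit) (Equiv.swap i ⟨i.val + 1, h⟩)) :=
  dif_pos h

theorem reflVec_of_last {i : Fin n} (h : i.val + 1 = n) :
    reflVec i = Equiv.swap (.inl i) (.inr (.inr i)) :=
  dif_neg h.not_lt

theorem reflVec_involutive (i : Fin n) : Function.Involutive (reflVec i) := by
  rcases succ_lt_or_succ_eq i with h | h
  · rw [reflVec_of_lt h]
    rintro (p | _ | p) <;> simp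
  · rw [reflVec_of_last h]
    exact Equiv.swap_apply_self _ _

theorem vecWt_reflVec (i : Fin n) (a : VecIdx n) :
    vecWt (reflVec i a) = reflectionMap i (vecWt a) := by
  rcases succ_lt_or_succ_eq i with h | h
  · rcases a with p | _ | p <;>
      simp only [reflVec_of_lt h, Equiv.sumCongr_apply, Sum.map_inl, Sum.map_inr, vecWt, map_neg,
        map_zero, reflectionMap_eps_of_lt h]
  · rcases a with p | _ | p <;>
      simp only [reflVec_of_last h, Equiv.swap_apply_def, vecWt, map_neg, map_zero,
        reflectionMap_eps_of_last h] <;>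
      split_ifs <;> simp_all

/-- The weights of the basis vectors of the spin representation. -/
def spinWt (s : SpinIdx n) : Weight n := fun i =>
  (s i).toInt - (if h : i.val + 1 < n then s ⟨i.val + 1, h⟩ else !s i).toInt

/-- The action of the simple reflection `s_i` on the basis of the spin representation, by which
the weights are permuted. -/
def spinRefl (i : Fin n) (s : SpinIdx n) : SpinIdx n :=
  if h : i.val + 1 < n then s ∘ Equiv.swap i ⟨i.val + 1, h⟩ else Function.update s i (!s i)

theorem spinRefl_of_lt {i : Fin n} (h : i.val + 1 < n) (s : SpinIdx n) :
    spinRefl i s = s ∘ Equiv.swap i ⟨i.val + 1, h⟩ :=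
  dif_pos h

theorem spinRefl_of_last {i : Fin n} (h : i.val + 1 = n) (s : SpinIdx n) :
    spinRefl i s = Function.update s i (!s i) :=
  dif_neg h.not_lt

theorem spinRefl_involutive (i : Fin n) : Function.Involutive (spinRefl i) := by
  intro s
  rcases succ_lt_or_succ_eq i with h | h
  · simp [spinRefl_of_lt h, Function.comp_assoc, ← Equiv.coe_trans]
  · simp [spinRefl_of_last h]

theorem abs_spinWt_le (s : SpinIdx n) (i : Fin n) : |spinWt s i| ≤ 1 := by
  rw [spinWt]
  generalize (if h : i.val + 1 < n then s ⟨i.val + 1, h⟩ else !s i) = b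
  cases s i <;> cases b <;> decide

theorem two_smul_spinWt (s : SpinIdx n) :
    (2 : ℤ) • spinWt s = ∑ p, (if s p then (1 : ℤ) else -1) • eps p := by
  funext i
  have heps (p : Fin n) : eps p i =
      (if p = i then if i.val + 1 = n then 2 else 1 else 0)
        - if h : i.val + 1 < n then if p = ⟨i.val + 1, h⟩ then 1 else 0 else 0 := by
    simp only [eps, Fin.ext_iff]
    split_ifs <;> omega
  simp only [Finset.sum_apply, Pi.smul_apply, smul_eq_mul, heps, mul_sub, Finset.sum_sub_distrib,
    mul_ite, mul_zero, Finset.sum_ite_eq', Finset.mem_univ, if_true, spinWt]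
  rcases succ_lt_or_succ_eq i with h | h
  · have hne : ¬i.val + 1 = n := h.ne
    simp only [dif_pos h, hne, if_false, Finset.sum_ite_eq', Finset.mem_univ, if_true, mul_ite,
      mul_zero]
    cases s i <;> cases s ⟨i.val + 1, h⟩ <;> rfl
  · simp only [dif_neg h.not_lt, if_pos h, mul_zero, Finset.sum_const_zero]
    cases s i <;> rfl

theorem spinWt_spinRefl (i : Fin n) (s : SpinIdx n) :
    spinWt (spinRefl i s) = reflectionMap i (spinWt s) := by
  refine smul_right_injective _ (two_ne_zero : (2 : ℤ) ≠ 0) ?_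
  simp only [← map_zsmul, two_smul_spinWt, map_sum]
  rcases succ_lt_or_succ_eq i with h | h
  · rw [← Equiv.sum_comp (Equiv.swap i ⟨i.val + 1, h⟩)]
    simp only [map_zsmul, reflectionMap_eps_of_lt h, spinRefl_of_lt h, Function.comp_apply,
      Equiv.swap_apply_self]
  · refine Finset.sum_congr rfl fun p _ => ?_
    rw [map_zsmul, reflectionMap_eps_of_last h, spinRefl_of_last h]
    rcases eq_or_ne p i with rfl | hp
    · cases s p <;> simp
    · simp [hp]

end Weights

/-! ### The homomorphisms from `SL₂` -/

section RankOne

variable {n : ℕ}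

theorem reflectionMap_apply_self (i : Fin n) (μ : Weight n) : reflectionMap i μ i = -μ i := by
  have h : simpleRoot i i = 2 := proj_simpleRoot i
  rw [reflectionMap_apply, Pi.sub_apply, Pi.smul_apply, h, smul_eq_mul]
  ring

theorem vecWt_reflVec_self (i : Fin n) (a : VecIdx n) : vecWt (reflVec i a) i = -vecWt a i := by
  rw [vecWt_reflVec, reflectionMap_apply_self]

theorem spinWt_spinRefl_self (i : Fin n) (s : SpinIdx n) :
    spinWt (spinRefl i s) i = -spinWt s i := by
  rw [spinWt_spinRefl, reflectionMap_apply_self]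

/-- The vector representation of the group. -/
def vecRep : G n →* Matrix (VecIdx n) (VecIdx n) ℂ :=
  (Units.coeHom _).comp ((MonoidHom.fst _ _).comp (Subgroup.subtype _))

/-- The spin representation of the group. -/
def spinRep : G n →* Matrix (SpinIdx n) (SpinIdx n) ℂ :=
  (Units.coeHom _).comp ((MonoidHom.snd _ _).comp (Subgroup.subtype _))

/-- The vector representation, restricted to the subgroup of rank one attached to `i`. -/
def vecRankOne (i : Fin n) : Matrix (Fin 2) (Fin 2) ℂ →* Matrix (VecIdx n) (VecIdx n) ℂ :=
  if i.val + 1 < n then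
    stringRep (vecWt · i) (reflVec i) (reflVec_involutive i) (vecWt_reflVec_self i)
  else symSqRep (p := .inl i) (z := .inr (.inl ())) (q := .inr (.inr i)) (by simp) (by simp)
    (by simp)

/-- The spin representation, restricted to the subgroup of rank one attached to `i`. -/
def spinRankOne (i : Fin n) : Matrix (Fin 2) (Fin 2) ℂ →* Matrix (SpinIdx n) (SpinIdx n) ℂ :=
  stringRep (spinWt · i) (spinRefl i) (spinRefl_involutive i) (spinWt_spinRefl_self i)

theorem vecRankOne_mulVec_of_lt {i : Fin n} (h : i.val + 1 < n) (M : Matrix (Fin 2) (Fin 2) ℂ)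
    (f : VecIdx n → ℂ) (a : VecIdx n) :
    (vecRankOne i M *ᵥ f) a =
      if vecWt a i = 1 then M 0 0 * f a + M 0 1 * f (reflVec i a)
      else if vecWt a i = -1 then M 1 0 * f (reflVec i a) + M 1 1 * f a
      else f a := by
  rw [vecRankOne, if_pos h]
  exact stringMatrix_mulVec _ _ _ _ _

theorem vecRankOne_mulVec_of_last {i : Fin n} (h : i.val + 1 = n) (M : Matrix (Fin 2) (Fin 2) ℂ)
    (f : VecIdx n → ℂ) (a : VecIdx n) :
    (vecRankOne i M *ᵥ f) a =
      if a = .inl i then M 0 0 ^ 2 * f (.inl i) + 2 * M 0 0 * M 0 1 * f (.inr (.inl ()))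
        + M 0 1 ^ 2 * f (.inr (.inr i))
      else if a = .inr (.inl ()) then M 0 0 * M 1 0 * f (.inl i)
        + (M 0 0 * M 1 1 + M 0 1 * M 1 0) * f (.inr (.inl ())) + M 0 1 * M 1 1 * f (.inr (.inr i))
      else if a = .inr (.inr i) then M 1 0 ^ 2 * f (.inl i)
        + 2 * M 1 0 * M 1 1 * f (.inr (.inl ())) + M 1 1 ^ 2 * f (.inr (.inr i))
      else f a := by
  rw [vecRankOne, if_neg h.not_lt]
  exact symSqMatrix_mulVec _ _ _ _ _ _

theorem spinRankOne_mulVec (i : Fin n) (M : Matrix (Fin 2) (Fin 2) ℂ) (f : SpinIdx n → ℂ)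
    (s : SpinIdx n) :
    (spinRankOne i M *ᵥ f) s =
      if spinWt s i = 1 then M 0 0 * f s + M 0 1 * f (spinRefl i s)
      else if spinWt s i = -1 then M 1 0 * f (spinRefl i s) + M 1 1 * f s
      else f s :=
  stringMatrix_mulVec _ _ _ _ _

theorem vecE_of_lt {i : Fin n} (h : i.val + 1 < n) (a b : VecIdx n) :
    vecE i a b = if vecWt a i = 1 ∧ b = reflVec i a then 1 else 0 := by
  rw [reflVec_of_lt h]
  rcases a with p | _ | p <;> rcases b with q | _ | q <;>
    simp [vecE, vecWt, eps, Fin.ext_iff, Equiv.swap_apply_def] <;> grind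

theorem vecF_of_lt {i : Fin n} (h : i.val + 1 < n) (a b : VecIdx n) :
    vecF i a b = if vecWt a i = -1 ∧ b = reflVec i a then 1 else 0 := by
  rw [reflVec_of_lt h]
  rcases a with p | _ | p <;> rcases b with q | _ | q <;>
    simp [vecF, vecWt, eps, Fin.ext_iff, Equiv.swap_apply_def] <;> grind

theorem vecE_of_last {i : Fin n} (h : i.val + 1 = n) (a b : VecIdx n) :
    vecE i a b = if a = .inl i ∧ b = .inr (.inl ()) then 2
      else if a = .inr (.inl ()) ∧ b = .inr (.inr i) then 1 else 0 := by
  rcases a with p | _ | p <;> rcases b with q | _ | q <;>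
    simp [vecE, Fin.ext_iff, h] <;> omega

theorem vecF_of_last {i : Fin n} (h : i.val + 1 = n) (a b : VecIdx n) :
    vecF i a b = if a = .inr (.inr i) ∧ b = .inr (.inl ()) then 2
      else if a = .inr (.inl ()) ∧ b = .inl i then 1 else 0 := by
  rcases a with p | _ | p <;> rcases b with q | _ | q <;>
    simp [vecF, Fin.ext_iff, h] <;> omega

theorem update_update_eq_iff {α β : Type*} [DecidableEq α] {i j : α} (hij : i ≠ j) (s u : α → β)
    (x y : β) : (s i = x ∧ s j = y ∧ u = Function.update (Function.update s i y) j x) ↔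
      (u i = y ∧ u j = x ∧ s = u ∘ Equiv.swap i j) := by
  constructor
  · rintro ⟨rfl, rfl, rfl⟩
    refine ⟨by simp [hij], by simp, funext fun p => ?_⟩
    rw [Function.comp_apply, Equiv.swap_apply_def]
    split_ifs <;> simp_all
  · rintro ⟨rfl, rfl, rfl⟩
    refine ⟨by simp, by simp, funext fun p => ?_⟩
    by_cases hpj : p = j
    · simp [hpj]
    by_cases hpi : p = i <;> simp [hpi, hpj, hij, Equiv.swap_apply_of_ne_of_ne]

theorem update_eq_iff {α β : Type*} [DecidableEq α] {i : α} (s u : α → β) (x y : β) :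
    (s i = x ∧ u = Function.update s i y) ↔ (u i = y ∧ s = Function.update u i x) := by
  constructor <;> rintro ⟨rfl, rfl⟩ <;> simp

theorem spinE_apply (i : Fin n) (a b : SpinIdx n) :
    spinE i a b = if spinWt a i = 1 ∧ b = spinRefl i a then 1 else 0 := by
  rcases succ_lt_or_succ_eq i with h | h
  · simp only [spinE, Matrix.of_apply, dif_pos h, spinRefl_of_lt h, spinWt,
      update_update_eq_iff (show i ≠ ⟨i.val + 1, h⟩ by simp [Fin.ext_iff])]
    cases a i <;> cases a ⟨i.val + 1, h⟩ <;> simp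
  · simp only [spinE, Matrix.of_apply, dif_neg h.not_lt, spinRefl_of_last h, spinWt,
      update_eq_iff b a false true]
    cases a i <;> simp

theorem spinF_apply (i : Fin n) (a b : SpinIdx n) :
    spinF i a b = if spinWt a i = -1 ∧ b = spinRefl i a then 1 else 0 := by
  rcases succ_lt_or_succ_eq i with h | h
  · simp only [spinF, Matrix.of_apply, dif_pos h, spinRefl_of_lt h, spinWt,
      update_update_eq_iff (show i ≠ ⟨i.val + 1, h⟩ by simp [Fin.ext_iff])]
    cases a i <;> cases a ⟨i.val + 1, h⟩ <;> simp
  · simp only [spinF, Matrix.of_apply, dif_neg h.not_lt, spinRefl_of_last h, spinWt,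
      update_eq_iff b a true false]
    cases a i <;> simp

theorem vecRep_x (i : Fin n) (t : ℂ) : vecRep (x i t) = vecRankOne i !![1, t; 0, 1] := by
  change NormedSpace.exp (t • vecE i) = _
  rcases succ_lt_or_succ_eq i with h | h
  · rw [exp_smul_eq_stringMatrix_upper (vecWt_reflVec_self i) (vecE_of_lt h), vecRankOne, if_pos h]
    rfl
  · rw [exp_smul_eq_symSqMatrix_upper (by simp) (by simp) (by simp) (vecE_of_last h), vecRankOne,
      if_neg h.not_lt]
    rfl

theorem vecRep_y (i : Fin n) (t : ℂ) : vecRep (y i t) = vecRankOne i !![1, 0; t, 1] := by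
  change NormedSpace.exp (t • vecF i) = _
  rcases succ_lt_or_succ_eq i with h | h
  · rw [exp_smul_eq_stringMatrix_lower (vecWt_reflVec_self i) (vecF_of_lt h), vecRankOne, if_pos h]
    rfl
  · rw [exp_smul_eq_symSqMatrix_lower (by simp) (by simp) (by simp) (vecF_of_last h), vecRankOne,
      if_neg h.not_lt]
    rfl

theorem spinRep_x (i : Fin n) (t : ℂ) : spinRep (x i t) = spinRankOne i !![1, t; 0, 1] :=
  exp_smul_eq_stringMatrix_upper (spinWt_spinRefl_self i) (spinE_apply i) t

theorem spinRep_y (i : Fin n) (t : ℂ) : spinRep (y i t) = spinRankOne i !![1, 0; t, 1] :=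
  exp_smul_eq_stringMatrix_lower (spinWt_spinRefl_self i) (spinF_apply i) t

/-- The direct sum of the vector and the spin representation, as a pair of matrices. -/
def rep : G n →* Matrix (VecIdx n) (VecIdx n) ℂ × Matrix (SpinIdx n) (SpinIdx n) ℂ :=
  vecRep.prod spinRep

theorem rep_injective : Function.Injective (rep : G n → _) := fun _ _ h =>
  Subtype.ext (Prod.ext (Units.ext (congrArg Prod.fst h)) (Units.ext (congrArg Prod.snd h)))

/-- The action of `2 × 2` matrices through the subgroup of rank one attached to `i`. Its restriction
to `SL₂` is the composition of `rep` with the homomorphism `φ_i : SL₂ → G`. -/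
def rankOne (i : Fin n) : Matrix (Fin 2) (Fin 2) ℂ →*
    Matrix (VecIdx n) (VecIdx n) ℂ × Matrix (SpinIdx n) (SpinIdx n) ℂ :=
  (vecRankOne i).prod (spinRankOne i)

theorem rep_x (i : Fin n) (t : ℂ) : rep (x i t) = rankOne i !![1, t; 0, 1] :=
  Prod.ext (vecRep_x i t) (spinRep_x i t)

theorem rep_y (i : Fin n) (t : ℂ) : rep (y i t) = rankOne i !![1, 0; t, 1] :=
  Prod.ext (vecRep_y i t) (spinRep_y i t)

theorem rep_sBar (i : Fin n) : rep (sBar i) = rankOne i !![0, -1; 1, 0] := by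
  rw [sBar, map_mul, map_mul, rep_x, rep_y, ← map_mul, ← map_mul]
  simp

theorem rep_coroot (i : Fin n) (c : ℂˣ) :
    rep (coroot i c) = rankOne i !![(c : ℂ), 0; 0, (c : ℂ)⁻¹] := by
  rw [coroot, map_mul, map_mul, map_mul, rep_x, rep_y, rep_sBar, ← map_mul, ← map_mul, ← map_mul]
  simp

theorem rep_yBold (i : Fin n) (c : ℂˣ) :
    rep (yBold i c) = rankOne i !![(c : ℂ)⁻¹, 0; 1, c] := by
  rw [yBold, map_mul, rep_y, rep_coroot, ← map_mul]
  simp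

theorem rep_inv_of_mul_eq_one {g : G n} {i : Fin n} {M N : Matrix (Fin 2) (Fin 2) ℂ}
    (hg : rep g = rankOne i M) (h : M * N = 1) : rep g⁻¹ = rankOne i N := by
  rw [← mul_one (rep g⁻¹), ← map_one (rankOne i), ← h, map_mul, ← hg, ← mul_assoc, ← map_mul,
    inv_mul_cancel, map_one, one_mul]

theorem rep_sBar_inv (i : Fin n) : rep (sBar i)⁻¹ = rankOne i !![0, 1; -1, 0] :=
  rep_inv_of_mul_eq_one (rep_sBar i) (by simp [Matrix.one_fin_two])

/-- The diagonal matrices with entries `χ (wt a)`, `a` running through the basis vectors. -/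
def weightDiagonal : (Weight n → ℂ) →*
    Matrix (VecIdx n) (VecIdx n) ℂ × Matrix (SpinIdx n) (SpinIdx n) ℂ where
  toFun χ := (Matrix.diagonal fun a => χ (vecWt a), Matrix.diagonal fun s => χ (spinWt s))
  map_one' := by simp [Prod.one_eq_mk]
  map_mul' χ χ' := by simp

theorem abs_vecWt_le_of_lt {i : Fin n} (h : i.val + 1 < n) (a : VecIdx n) : |vecWt a i| ≤ 1 := by
  have heps (p : Fin n) : |eps p i| ≤ 1 := by
    simp only [eps, h.ne, if_false]
    split_ifs <;> simp
  rcases a with p | _ | p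
  · exact heps p
  · simp [vecWt]
  · simpa [vecWt] using heps p

theorem rep_coroot_eq_weightDiagonal (i : Fin n) (c : ℂˣ) :
    rep (coroot i c) = weightDiagonal fun μ => (c : ℂ) ^ μ i := by
  rw [rep_coroot]
  refine Prod.ext (ext_mulVec fun f a => ?_) (ext_mulVec fun f s => ?_)
  · change (vecRankOne i _ *ᵥ f) a = (Matrix.diagonal _ *ᵥ f) a
    rw [Matrix.mulVec_diagonal]
    rcases succ_lt_or_succ_eq i with h | h
    · have := abs_le.1 (abs_vecWt_le_of_lt h a)
      obtain ha | ha | ha : vecWt a i = 1 ∨ vecWt a i = -1 ∨ vecWt a i = 0 := by omega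
      all_goals simp [vecRankOne_mulVec_of_lt h, ha]
    · have h' (p : Fin n) : i.val + 1 ≠ p.val := by omega
      rw [vecRankOne_mulVec_of_last h]
      rcases a with p | _ | p
      · rcases eq_or_ne p i with rfl | hp
        · simp [vecWt, eps, h, zpow_ofNat]
        · simp [vecWt, eps, h', hp, hp.symm]
      · simp [vecWt]
      · rcases eq_or_ne p i with rfl | hp
        · simp [vecWt, eps, h, zpow_ofNat]
        · simp [vecWt, eps, h', hp, hp.symm]
  · change (spinRankOne i _ *ᵥ f) s = (Matrix.diagonal _ *ᵥ f) s
    rw [Matrix.mulVec_diagonal, spinRankOne_mulVec]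
    have := abs_le.1 (abs_spinWt_le s i)
    obtain h | h | h : spinWt s i = 1 ∨ spinWt s i = -1 ∨ spinWt s i = 0 := by omega
    all_goals simp [h]

/-- The value at `torus a` of the character `μ` of the maximal torus. -/
def torusChar (a : Fin n → ℂˣ) (μ : Weight n) : ℂˣ := ∏ i, a i ^ μ i

theorem rep_torus (a : Fin n → ℂˣ) :
    rep (torus a) = weightDiagonal fun μ => (torusChar a μ : ℂ) := by
  rw [torus, map_list_prod, List.map_ofFn]
  have hcomp : rep ∘ (fun i => coroot i (a i)) =
      weightDiagonal ∘ fun i (μ : Weight n) => (a i : ℂ) ^ μ i :=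
    funext fun i => rep_coroot_eq_weightDiagonal i (a i)
  rw [hcomp, ← List.map_ofFn, ← map_list_prod, List.prod_ofFn]
  congr 1
  funext μ
  simp [torusChar]

end RankOne

/-! ### Relations between the generators -/

section Relations

variable {n : ℕ}

theorem torus_one : torus (1 : Fin n → ℂˣ) = 1 := by
  refine rep_injective ?_
  rw [rep_torus, map_one, ← map_one weightDiagonal]
  congr 1
  funext μ
  simp [torusChar]

theorem torus_mul (a b : Fin n → ℂˣ) : torus a * torus b = torus (a * b) := by
  refine rep_injective ?_
  rw [map_mul, rep_torus, rep_torus, rep_torus, ← map_mul]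
  congr 1
  funext μ
  simp [torusChar, mul_zpow, Finset.prod_mul_distrib]

theorem coroot_eq_torus (i : Fin n) (c : ℂˣ) : coroot i c = torus (Pi.mulSingle i c) := by
  refine rep_injective ?_
  rw [rep_torus, rep_coroot_eq_weightDiagonal]
  congr 1
  funext μ
  have hchar : torusChar (Pi.mulSingle i c) μ = c ^ μ i := by
    rw [torusChar, Finset.prod_eq_single i (fun j _ hj => by simp [hj]) (by simp),
      Pi.mulSingle_eq_same]
  rw [hchar, Units.val_zpow_eq_zpow_val]

theorem torusChar_add (a : Fin n → ℂˣ) (μ ν : Weight n) :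
    torusChar a (μ + ν) = torusChar a μ * torusChar a ν := by
  simp [torusChar, _root_.zpow_add, Finset.prod_mul_distrib]

section Exp

variable {m : Type*} [Fintype m] [DecidableEq m]

open scoped Matrix.Norms.Operator in
theorem diagonal_mul_exp_smul {d : m → ℂ} {u : ℂ} {A : Matrix m m ℂ}
    (h : ∀ a b, A a b ≠ 0 → d a = u * d b) (t : ℂ) :
    Matrix.diagonal d * NormedSpace.exp (t • A) =
      NormedSpace.exp ((u * t) • A) * Matrix.diagonal d := by
  refine SemiconjBy.exp_right ?_
  ext a b
  rw [Matrix.diagonal_mul, Matrix.mul_diagonal, Matrix.smul_apply, Matrix.smul_apply]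
  by_cases hab : A a b = 0
  · simp [hab]
  · rw [h a b hab, smul_eq_mul, smul_eq_mul]
    ring

open scoped Matrix.Norms.Operator in
theorem commute_exp_smul {A B : Matrix m m ℂ} (h : Commute A B) (s t : ℂ) :
    Commute (NormedSpace.exp (s • A)) (NormedSpace.exp (t • B)) :=
  ((h.smul_left s).smul_right t).exp

end Exp

theorem vecWt_of_vecE_ne_zero {i : Fin n} {a b : VecIdx n} (h : vecE i a b ≠ 0) :
    vecWt a = simpleRoot i + vecWt b := by
  rcases succ_lt_or_succ_eq i with hi | hi
  · rw [vecE_of_lt hi] at h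
    obtain ⟨ha, rfl⟩ : vecWt a i = 1 ∧ b = reflVec i a := by simpa using h
    rw [vecWt_reflVec, reflectionMap_apply, ha, one_smul, add_sub_cancel]
  · rw [vecE_of_last hi] at h
    rw [simpleRoot_of_last hi]
    split_ifs at h with h1 h2
    · simp [h1, vecWt]
    · simp [h2, vecWt]
    · exact absurd rfl h

theorem vecWt_of_vecF_ne_zero {i : Fin n} {a b : VecIdx n} (h : vecF i a b ≠ 0) :
    vecWt b = simpleRoot i + vecWt a := by
  rcases succ_lt_or_succ_eq i with hi | hi
  · rw [vecF_of_lt hi] at h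
    obtain ⟨ha, rfl⟩ : vecWt a i = -1 ∧ b = reflVec i a := by simpa using h
    rw [vecWt_reflVec, reflectionMap_apply, ha, neg_one_smul, sub_neg_eq_add, add_comm]
  · rw [vecF_of_last hi] at h
    rw [simpleRoot_of_last hi]
    split_ifs at h with h1 h2
    · simp [h1, vecWt]
    · simp [h2, vecWt]
    · exact absurd rfl h

theorem spinWt_of_spinE_ne_zero {i : Fin n} {a b : SpinIdx n} (h : spinE i a b ≠ 0) :
    spinWt a = simpleRoot i + spinWt b := by
  rw [spinE_apply] at h
  obtain ⟨ha, rfl⟩ : spinWt a i = 1 ∧ b = spinRefl i a := by simpa using h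
  rw [spinWt_spinRefl, reflectionMap_apply, ha, one_smul, add_sub_cancel]

theorem spinWt_of_spinF_ne_zero {i : Fin n} {a b : SpinIdx n} (h : spinF i a b ≠ 0) :
    spinWt b = simpleRoot i + spinWt a := by
  rw [spinF_apply] at h
  obtain ⟨ha, rfl⟩ : spinWt a i = -1 ∧ b = spinRefl i a := by simpa using h
  rw [spinWt_spinRefl, reflectionMap_apply, ha, neg_one_smul, sub_neg_eq_add, add_comm]

theorem torus_mul_x (a : Fin n → ℂˣ) (i : Fin n) (t : ℂ) :
    torus a * x i t = x i (torusChar a (simpleRoot i) * t) * torus a := by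
  refine rep_injective ?_
  rw [map_mul, map_mul, rep_torus]
  refine Prod.ext (diagonal_mul_exp_smul (fun b b' h => ?_) t)
    (diagonal_mul_exp_smul (fun b b' h => ?_) t)
  · beta_reduce
    rw [vecWt_of_vecE_ne_zero h, torusChar_add, Units.val_mul]
  · beta_reduce
    rw [spinWt_of_spinE_ne_zero h, torusChar_add, Units.val_mul]

theorem torus_mul_y (a : Fin n → ℂˣ) (i : Fin n) (t : ℂ) :
    torus a * y i t = y i ((torusChar a (simpleRoot i))⁻¹ * t) * torus a := by
  refine rep_injective ?_
  rw [map_mul, map_mul, rep_torus]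
  refine Prod.ext (diagonal_mul_exp_smul (fun b b' h => ?_) t)
    (diagonal_mul_exp_smul (fun b b' h => ?_) t)
  · beta_reduce
    rw [vecWt_of_vecF_ne_zero h, torusChar_add, Units.val_mul,
      Units.inv_mul_cancel_left]
  · beta_reduce
    rw [spinWt_of_spinF_ne_zero h, torusChar_add, Units.val_mul,
      Units.inv_mul_cancel_left]

theorem commute_vecE_vecF {i j : Fin n} (hij : i ≠ j) : Commute (vecE j) (vecF i) := by
  -- both products vanish, as `α_j - α_i` is not a difference of two weights
  have hEF : vecE j * vecF i = 0 := by
    ext a c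
    rw [Matrix.mul_apply]
    refine Finset.sum_eq_zero fun b _ => ?_
    rcases a with p | _ | p <;> rcases b with q | _ | q <;> rcases c with r | _ | r <;>
      simp [vecE, vecF, Fin.ext_iff] <;> grind
  have hFE : vecF i * vecE j = 0 := by
    ext a c
    rw [Matrix.mul_apply]
    refine Finset.sum_eq_zero fun b _ => ?_
    rcases a with p | _ | p <;> rcases b with q | _ | q <;> rcases c with r | _ | r <;>
      simp [vecE, vecF, Fin.ext_iff] <;> grind
  rw [Commute, SemiconjBy, hEF, hFE]

theorem spinWt_injective : Function.Injective (spinWt : SpinIdx n → Weight n) := by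
  intro s s' h
  suffices ∀ k, ∀ p : Fin n, p.val + k + 1 = n → s p = s' p from
    funext fun p => this (n - 1 - p.val) p (by omega)
  intro k
  induction k with
  | zero =>
    intro p hp
    have hp' := congrFun h p
    simp only [spinWt, dif_neg (show ¬p.val + 1 < n by omega)] at hp'
    revert hp'
    cases s p <;> cases s' p <;> decide
  | succ k ih =>
    intro p hp
    have hp' := congrFun h p
    have hlt : p.val + 1 < n := by omega
    simp only [spinWt, dif_pos hlt, ih ⟨p.val + 1, hlt⟩ (by simp; omega), sub_left_inj] at hp'
    revert hp'
    cases s p <;> cases s' p <;> decide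

theorem spinWt_spinRefl_apply (i j : Fin n) (s : SpinIdx n) :
    spinWt (spinRefl j s) i = spinWt s i - spinWt s j * simpleRoot j i := by
  rw [spinWt_spinRefl, reflectionMap_apply, Pi.sub_apply, Pi.smul_apply, smul_eq_mul]

theorem spinRefl_comm {i j : Fin n} (hij : simpleRoot i j = 0) (hji : simpleRoot j i = 0)
    (s : SpinIdx n) : spinRefl i (spinRefl j s) = spinRefl j (spinRefl i s) := by
  refine spinWt_injective (funext fun l => ?_)
  simp only [spinWt_spinRefl_apply, hij, hji]
  ring

theorem commute_spinE_spinF {i j : Fin n} (hij : i ≠ j) : Commute (spinE j) (spinF i) := by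
  refine ext_mulVec fun f s => ?_
  simp only [← Matrix.mulVec_mulVec, mulVec_of_apply_eq_ite (spinE_apply j),
    mulVec_of_apply_eq_ite (spinF_apply i), ← ite_and]
  have hs_i := abs_le.1 (abs_spinWt_le s i)
  have hs_j := abs_le.1 (abs_spinWt_le s j)
  have hroot : simpleRoot i j = 0 ∧ simpleRoot j i = 0 ∨
      simpleRoot i j < 0 ∧ simpleRoot j i < 0 := by
    simp only [simpleRoot, CartanMatrix.B, Matrix.of_apply, Fin.ext_iff] at *
    grind
  rcases hroot with ⟨h, h'⟩ | ⟨h, h'⟩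
  · simp only [spinWt_spinRefl_apply, h, h', mul_zero, sub_zero, spinRefl_comm h h',
      and_comm (a := spinWt s i = -1)]
  · rw [if_neg, if_neg] <;> rintro ⟨h1, h2⟩ <;> rw [spinWt_spinRefl_apply, h1] at h2 <;> omega

theorem commute_x_y {i j : Fin n} (hij : i ≠ j) (s t : ℂ) : Commute (x j s) (y i t) := by
  refine rep_injective ?_
  rw [map_mul, map_mul]
  exact Prod.ext (commute_exp_smul (commute_vecE_vecF hij) s t)
    (commute_exp_smul (commute_spinE_spinF hij) s t)

theorem x_mul_y (i : Fin n) (s t : ℂ) (u : ℂˣ) (hu : (u : ℂ) = 1 + t * s) :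
    x i t * y i s = y i (s / u) * coroot i u * x i (t / u) := by
  refine rep_injective ?_
  have hu0 := u.ne_zero
  simp only [map_mul, rep_x, rep_y, rep_coroot]
  simp only [← map_mul]
  congr 1
  ext p q
  fin_cases p <;> fin_cases q <;> simp <;> field_simp <;> simp [hu, mul_comm, add_comm]

end Relations

/-! ### Density of the big cell -/

section BigCell

variable {n : ℕ}

theorem x_inv (i : Fin n) (t : ℂ) : (x i t)⁻¹ = x i (-t) := by
  refine rep_injective ?_
  rw [rep_inv_of_mul_eq_one (rep_x i t) (N := !![1, -t; 0, 1]) (by simp [Matrix.one_fin_two]),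
    rep_x]

theorem y_inv (i : Fin n) (t : ℂ) : (y i t)⁻¹ = y i (-t) := by
  refine rep_injective ?_
  rw [rep_inv_of_mul_eq_one (rep_y i t) (N := !![1, 0; -t, 1]) (by simp [Matrix.one_fin_two]),
    rep_y]

theorem closure_x_y : Subgroup.closure {g : G n | ∃ i t, g = x i t ∨ g = y i t} = ⊤ := by
  rw [← Subgroup.closure_closure_coe_preimage]
  congr 1
  ext g
  simp only [Set.mem_ofPred_eq, Set.mem_preimage, Subtype.ext_iff]
  rfl

section Exp

variable {m : Type} [Fintype m] [DecidableEq m]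

open scoped Matrix.Norms.Operator in
theorem continuous_expUnit_smul (A : Matrix m m ℂ) : Continuous fun t : ℂ => expUnit (t • A) :=
  Units.continuous_iff.2 ⟨NormedSpace.exp_continuous.comp (continuous_id.smul continuous_const),
    NormedSpace.exp_continuous.comp (continuous_id.smul continuous_const).neg⟩

end Exp

theorem continuous_y (i : Fin n) : Continuous (y i) :=
  ((continuous_expUnit_smul (vecF i)).prodMk (continuous_expUnit_smul (spinF i))).subtype_mk _

/-- The big cell `U⁻ T U` of the group. -/
def bigCell (n : ℕ) : Set (G n) :=
  {g | ∃ u ∈ UMinus n, ∃ a : Fin n → ℂˣ, ∃ v ∈ UPlus n, g = u * torus a * v}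

theorem mul_x_mem_bigCell {g : G n} (hg : g ∈ bigCell n) (i : Fin n) (t : ℂ) :
    g * x i t ∈ bigCell n := by
  obtain ⟨u, hu, a, v, hv, rfl⟩ := hg
  exact ⟨u, hu, a, v * x i t, mul_mem hv (Subgroup.subset_closure ⟨i, t, rfl⟩), mul_assoc _ _ _⟩

theorem exists_mul_torus_eq {v : G n} (hv : v ∈ UPlus n) (a : Fin n → ℂˣ) :
    ∃ v' ∈ UPlus n, v * torus a = torus a * v' := by
  have hx (j : Fin n) (t : ℂ) : x j t * torus a =
      torus a * x j (((torusChar a (simpleRoot j))⁻¹ : ℂˣ) * t) := by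
    rw [torus_mul_x, Units.mul_inv_cancel_left]
  induction hv using Subgroup.closure_induction_left with
  | one => exact ⟨1, one_mem _, by simp⟩
  | mul_left w hw v _ ih =>
    obtain ⟨j, t, rfl⟩ := hw
    obtain ⟨v', hv', h⟩ := ih
    exact ⟨_, mul_mem (Subgroup.subset_closure ⟨j, _, rfl⟩) hv',
      by rw [mul_assoc, h, ← mul_assoc, hx, mul_assoc]⟩
  | inv_mul_cancel w hw v _ ih =>
    obtain ⟨j, t, rfl⟩ := hw
    obtain ⟨v', hv', h⟩ := ih
    exact ⟨_, mul_mem (Subgroup.subset_closure ⟨j, _, rfl⟩) hv',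
      by rw [x_inv, mul_assoc, h, ← mul_assoc, hx, mul_assoc]⟩

theorem mul_coroot_mem_bigCell {g : G n} (hg : g ∈ bigCell n) (i : Fin n) (c : ℂˣ) :
    g * coroot i c ∈ bigCell n := by
  obtain ⟨u, hu, a, v, hv, rfl⟩ := hg
  obtain ⟨v', hv', h⟩ := exists_mul_torus_eq hv (Pi.mulSingle i c)
  exact ⟨u, hu, a * Pi.mulSingle i c, v', hv',
    by rw [coroot_eq_torus, mul_assoc, h, ← torus_mul]; simp only [mul_assoc]⟩

theorem mul_y_mem_bigCell {u : G n} (hu : u ∈ UMinus n) (a : Fin n → ℂˣ) (i : Fin n) (s : ℂ) :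
    u * torus a * y i s ∈ bigCell n := by
  rw [mul_assoc, torus_mul_y, ← mul_assoc]
  exact ⟨_, mul_mem hu (Subgroup.subset_closure ⟨i, _, rfl⟩), a, 1, one_mem _, (mul_one _).symm⟩

theorem mul_mem_closure_of_forall_mul_mem_closure {s : Set (G n)} {h : G n}
    (hs : ∀ g ∈ s, g * h ∈ closure s) {g : G n} (hg : g ∈ closure s) : g * h ∈ closure s := by
  have h := map_mem_closure (continuous_mul_const h) hg hs
  rwa [closure_closure] at h

theorem mul_x_mul_y_mem_closure_bigCell {g : G n} {i : Fin n}
    (hg : ∀ s, g * y i s ∈ closure (bigCell n)) (j : Fin n) (t s : ℂ) :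
    g * x j t * y i s ∈ closure (bigCell n) := by
  have hx {h : G n} (t : ℂ) (hh : h ∈ closure (bigCell n)) : h * x j t ∈ closure (bigCell n) :=
    mul_mem_closure_of_forall_mul_mem_closure
      (fun g hg => subset_closure (mul_x_mem_bigCell hg j t)) hh
  rcases ne_or_eq i j with hij | rfl
  · rw [mul_assoc, (commute_x_y hij t s).eq, ← mul_assoc]
    exact hx t (hg s)
  · have hdense : Dense {s : ℂ | 1 + t * s ≠ 0} := by
      refine (dense_compl_singleton (-t⁻¹)).mono fun s hs => ?_
      exact fun h => hs (neg_eq_iff_eq_neg.1 (eq_inv_of_mul_eq_one_right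
        (by linear_combination -h)))
    have hclosed : IsClosed {s : ℂ | g * x i t * y i s ∈ closure (bigCell n)} :=
      isClosed_closure.preimage (continuous_const.mul (continuous_y i))
    refine hclosed.closure_subset_iff.2 (fun s hs => ?_) (hdense s)
    rw [Set.mem_ofPred_eq, mul_assoc, x_mul_y i s t (Units.mk0 _ hs) rfl, ← mul_assoc, ← mul_assoc]
    exact hx _ (mul_mem_closure_of_forall_mul_mem_closure
      (fun g hg => subset_closure (mul_coroot_mem_bigCell hg i _)) (hg _))

theorem mul_y_mem_closure_bigCell {g : G n} (hg : g ∈ bigCell n) (i : Fin n) (s : ℂ) :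
    g * y i s ∈ closure (bigCell n) := by
  obtain ⟨u, hu, a, v, hv, rfl⟩ := hg
  revert s
  induction hv using Subgroup.closure_induction_right with
  | one => exact fun s => by simpa using subset_closure (mul_y_mem_bigCell hu a i s)
  | mul_right v _ w hw ih =>
    obtain ⟨j, t, rfl⟩ := hw
    intro s
    rw [← mul_assoc]
    exact mul_x_mul_y_mem_closure_bigCell ih j t s
  | mul_inv_cancel v _ w hw ih =>
    obtain ⟨j, t, rfl⟩ := hw
    intro s
    rw [← mul_assoc, x_inv]
    exact mul_x_mul_y_mem_closure_bigCell ih j _ s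

theorem dense_bigCell : Dense (bigCell n) := by
  have hstable (g : G n) (i : Fin n) (t : ℂ) (hg : g ∈ closure (bigCell n)) :
      g * x i t ∈ closure (bigCell n) ∧ g * y i t ∈ closure (bigCell n) :=
    ⟨mul_mem_closure_of_forall_mul_mem_closure
      (fun g hg => subset_closure (mul_x_mem_bigCell hg i t)) hg,
      mul_mem_closure_of_forall_mul_mem_closure
        (fun g hg => mul_y_mem_closure_bigCell hg i t) hg⟩
  intro g
  have hg : g ∈ Subgroup.closure {g : G n | ∃ i t, g = x i t ∨ g = y i t} := by
    rw [closure_x_y]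
    trivial
  induction hg using Subgroup.closure_induction_right with
  | one => exact subset_closure ⟨1, one_mem _, 1, 1, one_mem _, by simp [torus_one]⟩
  | mul_right g _ w hw ih =>
    obtain ⟨i, t, rfl | rfl⟩ := hw
    exacts [(hstable g i t ih).1, (hstable g i t ih).2]
  | mul_inv_cancel g _ w hw ih =>
    obtain ⟨i, t, rfl | rfl⟩ := hw
    · rw [x_inv]
      exact (hstable g i (-t) ih).1
    · rw [y_inv]
      exact (hstable g i (-t) ih).2

theorem continuous_coords : Continuous (coords : G n → _) := by
  refine continuous_pi ?_
  rintro (⟨a, b⟩ | ⟨a, b⟩)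
  · exact (Units.continuous_val.comp (continuous_fst.comp continuous_subtype_val)).matrix_elem a b
  · exact (Units.continuous_val.comp (continuous_snd.comp continuous_subtype_val)).matrix_elem a b

theorem IsRegular.continuous {F : G n → ℂ} (hF : IsRegular F) : Continuous F := by
  obtain ⟨p, hp⟩ := hF
  rw [funext hp]
  exact (MvPolynomial.continuous_eval p).comp continuous_coords

theorem IsPrincipalMinor.unique {μ : Weight n} {F F' : G n → ℂ} (hF : IsPrincipalMinor μ F)
    (hF' : IsPrincipalMinor μ F') : F = F' := by
  refine Continuous.ext_on dense_bigCell hF.1.continuous hF'.1.continuous ?_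
  rintro _ ⟨u, hu, a, v, hv, rfl⟩
  rw [hF.2 u hu a v hv, hF'.2 u hu a v hv]

theorem IsPrincipalMinor.principalMinor_eq {μ : Weight n} {F : G n → ℂ}
    (hF : IsPrincipalMinor μ F) : principalMinor μ = F := by
  have h : ∃ F : G n → ℂ, IsPrincipalMinor μ F := ⟨F, hF⟩
  rw [principalMinor, dif_pos h]
  exact h.choose_spec.unique hF

end BigCell

/-! ### The principal minors of the fundamental weights -/

section PrincipalMinors

variable {n : ℕ}

theorem IsPrincipalMinor.of_invariant {μ : Weight n} {F : G n → ℂ} (hF : IsRegular F)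
    (hy : ∀ i t g, F (y i t * g) = F g) (hx : ∀ i t g, F (g * x i t) = F g)
    (htorus : ∀ a, F (torus a) = torusChar a μ) : IsPrincipalMinor μ F := by
  refine ⟨hF, fun u hu a v hv => ?_⟩
  have hu' (g : G n) : F (u * g) = F g := by
    induction hu using Subgroup.closure_induction_left generalizing g with
    | one => rw [one_mul]
    | mul_left w hw u _ ih =>
      obtain ⟨i, t, rfl⟩ := hw
      rw [mul_assoc, hy, ih]
    | inv_mul_cancel w hw u _ ih =>
      obtain ⟨i, t, rfl⟩ := hw
      rw [mul_assoc, y_inv, hy, ih]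
  have hv' (g : G n) : F (g * v) = F g := by
    induction hv using Subgroup.closure_induction_right generalizing g with
    | one => rw [mul_one]
    | mul_right v _ w hw ih =>
      obtain ⟨i, t, rfl⟩ := hw
      rw [← mul_assoc, hx, ih]
    | mul_inv_cancel v _ w hw ih =>
      obtain ⟨i, t, rfl⟩ := hw
      rw [← mul_assoc, x_inv, hx, ih]
  rw [hv', hu', htorus]
  simp [torusChar]

theorem eps_eq_sub (p : Fin n) (h : p.val ≠ 0) :
    eps p = (if p.val + 1 = n then 2 else 1 : ℤ) • fundWeight p -
      fundWeight ⟨p.val - 1, by omega⟩ := by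
  funext i
  simp only [eps, fundWeight, Pi.sub_apply, Pi.smul_apply, Pi.single_apply, Fin.ext_iff]
  split_ifs <;> simp <;> omega

theorem sum_eps_castLE (k : Fin n) :
    ∑ p : Fin (k.val + 1), eps (Fin.castLE k.isLt p) =
      (if k.val + 1 = n then 2 else 1 : ℤ) • fundWeight k := by
  obtain ⟨k, hk⟩ := k
  induction k with
  | zero =>
    have h0 : Fin.castLE hk (0 : Fin (0 + 1)) = ⟨0, hk⟩ := rfl
    rw [Fin.sum_univ_one, h0]
    funext i
    simp only [eps, fundWeight, Pi.smul_apply, Pi.single_apply, Fin.ext_iff]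
    split_ifs <;> simp_all
  | succ k ih =>
    have ih' := ih (by omega)
    rw [if_neg (show ¬k + 1 = n by omega), one_smul] at ih'
    rw [Fin.sum_univ_castSucc, eps_eq_sub (Fin.castLE _ (Fin.last (k + 1))) (by simp),
      add_sub_left_comm]
    exact add_eq_left.2 (sub_eq_zero.2 ih')

theorem torusChar_sum {ι : Type*} (a : Fin n → ℂˣ) (s : Finset ι) (μ : ι → Weight n) :
    torusChar a (∑ p ∈ s, μ p) = ∏ p ∈ s, torusChar a (μ p) := by
  induction s using Finset.cons_induction with
  | empty => simp [torusChar]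
  | cons p s hp ih => rw [Finset.sum_cons, Finset.prod_cons, torusChar_add, ih]

theorem vecRankOne_mulVec_inl_of_lt {i : Fin n} (h : i.val + 1 < n)
    (M : Matrix (Fin 2) (Fin 2) ℂ) (f : VecIdx n → ℂ) (p : Fin n) :
    (vecRankOne i M *ᵥ f) (.inl p) =
      if p.val = i.val then M 0 0 * f (.inl i) + M 0 1 * f (.inl ⟨i.val + 1, h⟩)
      else if p.val = i.val + 1 then M 1 0 * f (.inl i) + M 1 1 * f (.inl ⟨i.val + 1, h⟩)
      else f (.inl p) := by
  rw [vecRankOne_mulVec_of_lt h, reflVec_of_lt h]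
  by_cases hpi : p.val = i.val
  · obtain rfl : p = i := Fin.ext hpi
    simp [vecWt, eps, h.ne]
  by_cases hpi' : p.val = i.val + 1
  · obtain rfl : p = ⟨i.val + 1, h⟩ := Fin.ext hpi'
    simp [vecWt, eps, Fin.ext_iff]
  · have hip : i ≠ p := fun hip => hpi (congrArg Fin.val hip.symm)
    simp [vecWt, eps, hip, hpi, hpi', Ne.symm hpi']

theorem vecRankOne_mulVec_inr_of_lt {i : Fin n} (h : i.val + 1 < n)
    (M : Matrix (Fin 2) (Fin 2) ℂ) (f : VecIdx n → ℂ) (p : Fin n) :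
    (vecRankOne i M *ᵥ f) (.inr (.inr p)) =
      if p.val = i.val then
        M 1 0 * f (.inr (.inr ⟨i.val + 1, h⟩)) + M 1 1 * f (.inr (.inr i))
      else if p.val = i.val + 1 then
        M 0 0 * f (.inr (.inr ⟨i.val + 1, h⟩)) + M 0 1 * f (.inr (.inr i))
      else f (.inr (.inr p)) := by
  rw [vecRankOne_mulVec_of_lt h, reflVec_of_lt h]
  by_cases hpi : p.val = i.val
  · obtain rfl : p = i := Fin.ext hpi
    simp [vecWt, eps, h.ne]
  by_cases hpi' : p.val = i.val + 1
  · obtain rfl : p = ⟨i.val + 1, h⟩ := Fin.ext hpi'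
    simp [vecWt, eps, Fin.ext_iff]
  · have hip : i ≠ p := fun hip => hpi (congrArg Fin.val hip.symm)
    simp [vecWt, eps, hip, hpi, hpi', Ne.symm hpi']

theorem vecRankOne_mulVec_mid_of_lt {i : Fin n} (h : i.val + 1 < n)
    (M : Matrix (Fin 2) (Fin 2) ℂ) (f : VecIdx n → ℂ) :
    (vecRankOne i M *ᵥ f) (.inr (.inl ())) = f (.inr (.inl ())) := by
  rw [vecRankOne_mulVec_of_lt h]
  simp [vecWt]

theorem vecRep_y_mulVec_inl (i : Fin n) (t : ℂ) (f : VecIdx n → ℂ) (p : Fin n) :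
    (vecRep (y i t) *ᵥ f) (.inl p) =
      f (.inl p) + if p.val = i.val + 1 then t * f (.inl i) else 0 := by
  rw [vecRep_y]
  rcases succ_lt_or_succ_eq i with h | h
  · rw [vecRankOne_mulVec_inl_of_lt h]
    by_cases hpi : p.val = i.val
    · obtain rfl : p = i := Fin.ext hpi
      simp
    by_cases hpi' : p.val = i.val + 1
    · obtain rfl : p = ⟨i.val + 1, h⟩ := Fin.ext hpi'
      simp [add_comm]
    · simp [hpi, hpi']
  · have hpi' : p.val ≠ i.val + 1 := by omega
    rw [vecRankOne_mulVec_of_last h, if_neg hpi', add_zero]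
    rcases eq_or_ne p i with rfl | hpi
    · simp
    · simp [hpi]

theorem vecRep_x_mulVec_single_inl (i : Fin n) (t : ℂ) (q : Fin n) :
    vecRep (x i t) *ᵥ Pi.single (.inl q) 1 =
      Pi.single (.inl q) 1 + Pi.single (.inl i) (if q.val = i.val + 1 then t else 0) := by
  rw [vecRep_x]
  funext a
  rcases succ_lt_or_succ_eq i with h | h
  · rcases a with p | _ | p
    · rw [vecRankOne_mulVec_inl_of_lt h]
      simp only [Pi.add_apply, Pi.single_apply, Sum.inl.injEq, Fin.ext_iff, Matrix.of_apply,
        Matrix.cons_val', Matrix.cons_val_zero, Matrix.cons_val_one, Matrix.cons_val_fin_one]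
      split_ifs <;> first | omega | simp
    · simp [vecRankOne_mulVec_mid_of_lt h]
    · simp [vecRankOne_mulVec_inr_of_lt h]
  · have hq : q.val ≠ i.val + 1 := by omega
    rw [vecRankOne_mulVec_of_last h, if_neg hq, Pi.single_zero, add_zero]
    simp only [Pi.single_apply, Matrix.of_apply,
      Matrix.cons_val', Matrix.cons_val_zero, Matrix.cons_val_one, Matrix.cons_val_fin_one]
    split_ifs <;> simp_all

theorem vecRep_y_mul_apply_inl (i : Fin n) (t : ℂ) (g : G n) (p : Fin n) (b : VecIdx n) :
    vecRep (y i t * g) (.inl p) b =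
      vecRep g (.inl p) b + if p.val = i.val + 1 then t * vecRep g (.inl i) b else 0 := by
  rw [map_mul]
  exact vecRep_y_mulVec_inl i t (fun a => vecRep g a b) p

theorem vecRep_mul_x_apply_inl (i : Fin n) (t : ℂ) (g : G n) (a : VecIdx n) (q : Fin n) :
    vecRep (g * x i t) a (.inl q) =
      vecRep g a (.inl q) + if q.val = i.val + 1 then t * vecRep g a (.inl i) else 0 := by
  have h := congrFun (congrArg (vecRep g *ᵥ ·) (vecRep_x_mulVec_single_inl i t q)) a
  beta_reduce at h
  rw [Matrix.mulVec_mulVec, ← map_mul, Matrix.mulVec_add] at h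
  split_ifs with hq
  · simpa [hq, mul_comm] using h
  · simpa [hq] using h

/-- The leading principal minor of order `k + 1` of the vector representation. -/
noncomputable def leadingMinor (k : Fin n) (g : G n) : ℂ :=
  ((vecRep g).submatrix (Sum.inl ∘ Fin.castLE k.isLt) (Sum.inl ∘ Fin.castLE k.isLt)).det

theorem isRegular_leadingMinor (k : Fin n) : IsRegular (leadingMinor k) := by
  refine ⟨Matrix.det (Matrix.of fun p q : Fin (k.val + 1) =>
    MvPolynomial.X (.inl (.inl (Fin.castLE k.isLt p), .inl (Fin.castLE k.isLt q)))), fun g => ?_⟩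
  rw [RingHom.map_det, leadingMinor]
  congr 1
  ext p q
  rw [RingHom.mapMatrix_apply, Matrix.map_apply, Matrix.of_apply, MvPolynomial.eval_X]
  rfl

theorem leadingMinor_y_mul (k i : Fin n) (t : ℂ) (g : G n) :
    leadingMinor k (y i t * g) = leadingMinor k g := by
  refine (Matrix.det_eq_of_forall_row_eq_smul_add_pred
    (fun p : Fin k.val => if p.val = i.val then -t else 0) (fun q => ?_) fun p q => ?_).symm
  · simp [vecRep_y_mul_apply_inl, -map_mul]
  · simp only [Matrix.submatrix_apply, Function.comp_apply, vecRep_y_mul_apply_inl, Fin.val_castLE,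
      Fin.val_succ, Nat.add_right_cancel_iff]
    split_ifs with hp
    · rw [show i = Fin.castLE k.isLt p.castSucc from Fin.ext hp.symm]
      ring
    · simp

theorem leadingMinor_mul_x (k i : Fin n) (t : ℂ) (g : G n) :
    leadingMinor k (g * x i t) = leadingMinor k g := by
  refine (Matrix.det_eq_of_forall_col_eq_smul_add_pred
    (fun q : Fin k.val => if q.val = i.val then -t else 0) (fun p => ?_) fun p q => ?_).symm
  · simp [vecRep_mul_x_apply_inl, -map_mul]
  · simp only [Matrix.submatrix_apply, Function.comp_apply, vecRep_mul_x_apply_inl, Fin.val_castLE,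
      Fin.val_succ, Nat.add_right_cancel_iff]
    split_ifs with hq
    · rw [show i = Fin.castLE k.isLt q.castSucc from Fin.ext hq.symm]
      ring
    · simp

theorem isPrincipalMinor_leadingMinor {k : Fin n} (hk : k.val + 1 < n) :
    IsPrincipalMinor (fundWeight k) (leadingMinor k) := by
  refine .of_invariant (isRegular_leadingMinor k) (leadingMinor_y_mul k)
    (leadingMinor_mul_x k) fun a => ?_
  have hdiag : vecRep (torus a) = Matrix.diagonal fun b => (torusChar a (vecWt b) : ℂ) :=
    congrArg Prod.fst (rep_torus a)
  have hsum := sum_eps_castLE k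
  rw [if_neg hk.ne, one_smul] at hsum
  rw [leadingMinor, hdiag, Matrix.submatrix_diagonal _ _
    (Sum.inl_injective.comp (Fin.castLE_injective _)), Matrix.det_diagonal, ← hsum, torusChar_sum]
  simp [vecWt]

/-- The matrix coefficient of the highest weight vector of the spin representation. -/
def spinCorner (g : G n) : ℂ := spinRep g ⊤ ⊤

theorem spinWt_top {k : Fin n} (hk : k.val + 1 = n) : spinWt (⊤ : SpinIdx n) = fundWeight k := by
  funext i
  simp only [spinWt, fundWeight, Pi.single_apply, Fin.ext_iff]
  split_ifs <;> first | omega | simp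

theorem isRegular_spinCorner : IsRegular (spinCorner (n := n)) :=
  ⟨MvPolynomial.X (.inr (⊤, ⊤)), fun g => by
    rw [MvPolynomial.eval_X]
    rfl⟩

theorem spinWt_top_ne (i : Fin n) : spinWt (⊤ : SpinIdx n) i ≠ -1 := by
  rw [spinWt]
  split_ifs <;> simp

theorem spinCorner_y_mul (i : Fin n) (t : ℂ) (g : G n) :
    spinCorner (y i t * g) = spinCorner g := by
  rw [spinCorner, map_mul, spinRep_y]
  change (spinRankOne i _ *ᵥ fun s => spinRep g s ⊤) ⊤ = _
  rw [spinRankOne_mulVec]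
  simp [spinWt_top_ne, spinCorner]

theorem spinRep_x_mulVec_single_top (i : Fin n) (t : ℂ) :
    spinRep (x i t) *ᵥ Pi.single ⊤ 1 = Pi.single ⊤ 1 := by
  funext s
  rw [spinRep_x, spinRankOne_mulVec]
  have h (hs : spinWt s i = 1) : spinRefl i s ≠ ⊤ := fun h => by
    have := spinWt_spinRefl_self i s
    rw [h, hs] at this
    exact spinWt_top_ne i this
  split_ifs with h1
  · simp [h h1]
  · simp
  · rfl

theorem spinCorner_mul_x (i : Fin n) (t : ℂ) (g : G n) :
    spinCorner (g * x i t) = spinCorner g := by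
  have h := congrFun (congrArg (spinRep g *ᵥ ·) (spinRep_x_mulVec_single_top i t)) ⊤
  beta_reduce at h
  rw [Matrix.mulVec_mulVec, ← map_mul] at h
  simpa [spinCorner, -map_mul] using h

theorem isPrincipalMinor_spinCorner {k : Fin n} (hk : k.val + 1 = n) :
    IsPrincipalMinor (fundWeight k) spinCorner := by
  refine .of_invariant isRegular_spinCorner spinCorner_y_mul spinCorner_mul_x fun a => ?_
  have hdiag : spinRep (torus a) = Matrix.diagonal fun s => (torusChar a (spinWt s) : ℂ) :=
    congrArg Prod.snd (rep_torus a)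
  rw [spinCorner, hdiag, Matrix.diagonal_apply_eq, spinWt_top hk]

end PrincipalMinors

/-! ### Reduced words -/

section ReducedWords

variable {n : ℕ}

/-- The involution `v_p ↔ v_{\bar p}` of the basis of the vector representation, which negates the
weights. -/
def bar : VecIdx n → VecIdx n
  | .inl p => .inr (.inr p)
  | .inr (.inl u) => .inr (.inl u)
  | .inr (.inr p) => .inl p

/-- The position of a basis vector of the vector representation in the order
`v_1 > ⋯ > v_n > v_0 > v_{\bar n} > ⋯ > v_{\bar 1}`, counted from the middle. -/
def level : VecIdx n → ℤ
  | .inl p => n - p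
  | .inr (.inl _) => 0
  | .inr (.inr p) => p - n

theorem bar_bar (a : VecIdx n) : bar (bar a) = a := by
  rcases a with p | _ | p <;> rfl

theorem level_bar (a : VecIdx n) : level (bar a) = -level a := by
  rcases a with p | _ | p <;> simp [bar, level]

theorem level_injective : Function.Injective (level : VecIdx n → ℤ) := by
  rintro (p | _ | p) (q | _ | q) h <;> simp only [level] at h
  all_goals first
    | rfl
    | omega
    | exact congrArg _ (Fin.ext (by omega))
    | exact congrArg (Sum.inr ∘ Sum.inr) (Fin.ext (by omega))

theorem reflVec_bar (i : Fin n) (a : VecIdx n) : reflVec i (bar a) = bar (reflVec i a) := by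
  rcases succ_lt_or_succ_eq i with h | h
  · rw [reflVec_of_lt h]
    rcases a with p | _ | p <;> rfl
  · rw [reflVec_of_last h]
    rcases a with p | _ | p <;> simp only [bar, Equiv.swap_apply_def] <;> split_ifs <;> simp_all

/-- The reflection of the basis of the vector representation which exchanges `x` and `y`, and hence
also `bar x` and `bar y`. -/
def signedSwap (x y : VecIdx n) : Equiv.Perm (VecIdx n) :=
  if y = bar x then Equiv.swap x y else Equiv.swap x y * Equiv.swap (bar x) (bar y)

theorem conj_signedSwap {π : Equiv.Perm (VecIdx n)} (hπ : ∀ a, π (bar a) = bar (π a))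
    (x y : VecIdx n) : π * signedSwap x y * π⁻¹ = signedSwap (π x) (π y) := by
  simp only [signedSwap, ← hπ, π.injective.eq_iff, Equiv.swap_apply_apply]
  split_ifs <;> group

theorem signedSwap_inl_inl (p q : Fin n) :
    signedSwap (.inl p) (.inl q) =
      Equiv.sumCongr (Equiv.swap p q) (Equiv.sumCongr (Equiv.refl Unit) (Equiv.swap p q)) := by
  rw [signedSwap, if_neg (by simp [bar])]
  refine Equiv.ext ?_
  rintro (r | _ | r) <;>
    simp only [bar, Equiv.Perm.mul_apply, Equiv.sumCongr_apply, Sum.map_inl, Sum.map_inr,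
      Equiv.swap_apply_def, Equiv.refl_apply] <;>
    split_ifs <;> grind

theorem signedSwap_inr_inr (p q : Fin n) :
    signedSwap (.inr (.inr p)) (.inr (.inr q)) =
      Equiv.sumCongr (Equiv.swap p q) (Equiv.sumCongr (Equiv.refl Unit) (Equiv.swap p q)) := by
  rw [signedSwap, if_neg (by simp [bar])]
  refine Equiv.ext ?_
  rintro (r | _ | r) <;>
    simp only [bar, Equiv.Perm.mul_apply, Equiv.sumCongr_apply, Sum.map_inl, Sum.map_inr,
      Equiv.swap_apply_def, Equiv.refl_apply] <;>
    split_ifs <;> grind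

theorem signedSwap_eq_reflVec {j : Fin n} {x y : VecIdx n} (hx : level x ≠ 0) (hy : level y ≠ 0)
    (hxy : level y < level x) (h : level (reflVec j x) ≤ level (reflVec j y)) :
    signedSwap x y = reflVec j := by
  rcases succ_lt_or_succ_eq j with hj | hj
  · rw [reflVec_of_lt hj] at h ⊢
    obtain ⟨rfl, rfl⟩ | ⟨rfl, rfl⟩ : (x = .inl j ∧ y = .inl ⟨j.val + 1, hj⟩) ∨
        (x = .inr (.inr ⟨j.val + 1, hj⟩) ∧ y = .inr (.inr j)) := by
      rcases x with p | _ | p <;> rcases y with q | _ | q <;>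
        simp only [level, Equiv.sumCongr_apply, Sum.map_inl, Sum.map_inr, Equiv.swap_apply_def,
          ne_eq, not_true_eq_false] at h hx hy hxy <;>
        simp only [Sum.inl.injEq, Sum.inr.injEq, Fin.ext_iff, reduceCtorEq] <;>
        split_ifs at h <;> simp_all [Fin.ext_iff] <;> omega
    · exact signedSwap_inl_inl _ _
    · rw [signedSwap_inr_inr, Equiv.swap_comm]
  · rw [reflVec_of_last hj] at h ⊢
    obtain ⟨rfl, rfl⟩ : x = .inl j ∧ y = .inr (.inr j) := by
      rcases x with p | _ | p <;> rcases y with q | _ | q <;>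
        simp only [level, Equiv.swap_apply_def, ne_eq, not_true_eq_false] at h hx hy hxy <;>
        simp only [Sum.inl.injEq, Sum.inr.injEq, Fin.ext_iff, reduceCtorEq] <;>
        split_ifs at h <;> simp_all [Fin.ext_iff] <;> omega
    exact if_pos rfl

/-- The action of the Weyl group element with the word `l` on the basis of the vector
representation. -/
def wordVec (l : List (Fin n)) : Equiv.Perm (VecIdx n) := (l.map reflVec).prod

theorem wordVec_cons (i : Fin n) (l : List (Fin n)) : wordVec (i :: l) = reflVec i * wordVec l :=
  List.prod_cons

theorem reflVec_mul_self (i : Fin n) : reflVec i * reflVec i = 1 :=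
  Equiv.ext (reflVec_involutive i)

theorem reflVec_inv (i : Fin n) : (reflVec i)⁻¹ = reflVec i :=
  inv_eq_of_mul_eq_one_left (reflVec_mul_self i)

theorem wordVec_cons_inv_apply (i : Fin n) (l : List (Fin n)) (a : VecIdx n) :
    (wordVec (i :: l))⁻¹ a = (wordVec l)⁻¹ (reflVec i a) := by
  rw [wordVec_cons, _root_.mul_inv_rev, reflVec_inv, Equiv.Perm.mul_apply]

theorem wordVec_bar (l : List (Fin n)) (a : VecIdx n) : wordVec l (bar a) = bar (wordVec l a) := by
  induction l with
  | nil => rfl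
  | cons i l ih => rw [wordVec_cons, Equiv.Perm.mul_apply, ih, reflVec_bar, Equiv.Perm.mul_apply]

theorem level_apply_ne_zero {π : Equiv.Perm (VecIdx n)} (hπ : ∀ a, π (bar a) = bar (π a))
    {a : VecIdx n} (h : level a ≠ 0) : level (π a) ≠ 0 := by
  have hmid {b : VecIdx n} : level b = 0 ↔ bar b = b := by
    rw [← level_injective.eq_iff, level_bar, neg_eq_self]
  rwa [Ne, hmid, ← hπ, π.injective.eq_iff, ← hmid]

theorem inv_apply_bar {π : Equiv.Perm (VecIdx n)} (hπ : ∀ a, π (bar a) = bar (π a))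
    (a : VecIdx n) : π⁻¹ (bar a) = bar (π⁻¹ a) := by
  rw [Equiv.Perm.inv_eq_iff_eq, hπ]
  exact (congrArg bar (π.apply_symm_apply a)).symm

theorem level_reflVec_inl_lt (i : Fin n) : level (reflVec i (.inl i)) < level (.inl i) := by
  rcases succ_lt_or_succ_eq i with h | h
  · simp [reflVec_of_lt, h, level]
  · simp only [reflVec_of_last, h, Equiv.swap_apply_left, level]
    omega

theorem exists_wordVec_eq_signedSwap_mul (l : List (Fin n)) {x y : VecIdx n} (hx : level x ≠ 0)
    (hy : level y ≠ 0) (hxy : level y < level x)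
    (h : level ((wordVec l)⁻¹ x) < level ((wordVec l)⁻¹ y)) :
    ∃ l' : List (Fin n), l'.length < l.length ∧ wordVec l' = signedSwap x y * wordVec l := by
  induction l generalizing x y with
  | nil => exact absurd h hxy.not_gt
  | cons j l ih =>
    rw [wordVec_cons_inv_apply, wordVec_cons_inv_apply] at h
    rcases lt_or_ge (level (reflVec j y)) (level (reflVec j x)) with hlt | hle
    · obtain ⟨l', hlen, hl'⟩ := ih (level_apply_ne_zero (reflVec_bar j) hx)
        (level_apply_ne_zero (reflVec_bar j) hy) hlt h
      refine ⟨j :: l', by simpa using hlen, ?_⟩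
      rw [wordVec_cons, hl', ← conj_signedSwap (reflVec_bar j), reflVec_inv, wordVec_cons]
      simp only [← mul_assoc, reflVec_mul_self, one_mul]
    · refine ⟨l, by simp, ?_⟩
      rw [signedSwap_eq_reflVec hx hy hxy hle, wordVec_cons, ← mul_assoc, reflVec_mul_self, one_mul]

/-- `s_i` is a left descent of the Weyl group element acting by `π`. -/
def IsDescent (i : Fin n) (π : Equiv.Perm (VecIdx n)) : Prop :=
  level (π⁻¹ (.inl i)) < level (π⁻¹ (reflVec i (.inl i)))

theorem IsDescent.exists_wordVec_eq_reflVec_mul {i : Fin n} {l : List (Fin n)}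
    (h : IsDescent i (wordVec l)) :
    ∃ l' : List (Fin n), l'.length < l.length ∧ wordVec l' = reflVec i * wordVec l := by
  have hi : 0 < level (Sum.inl i : VecIdx n) := by simp [level]
  have hlt := level_reflVec_inl_lt i
  have hi' := level_apply_ne_zero (reflVec_bar i) hi.ne'
  rw [← signedSwap_eq_reflVec hi.ne' hi' hlt (by rw [reflVec_involutive i]; exact hlt.le)]
  exact exists_wordVec_eq_signedSwap_mul l hi.ne' hi' hlt h

/-- `l` is a reduced word. -/
def IsReduced (l : List (Fin n)) : Prop :=
  ∀ l' : List (Fin n), wordVec l' = wordVec l → l.length ≤ l'.length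

theorem IsReduced.of_cons {i : Fin n} {l : List (Fin n)} (h : IsReduced (i :: l)) :
    IsReduced l := fun l' hl' => by
  simpa using h (i :: l') (by rw [wordVec_cons, wordVec_cons, hl'])

theorem IsReduced.not_isDescent {i : Fin n} {l : List (Fin n)} (h : IsReduced (i :: l)) :
    ¬IsDescent i (wordVec l) := fun hi => by
  obtain ⟨l', hlt, hl'⟩ := hi.exists_wordVec_eq_reflVec_mul
  have := h l' (hl'.trans (wordVec_cons i l).symm)
  rw [List.length_cons] at this
  omega

theorem prod_map_simpleRefl_vecWt (l : List (Fin n)) (a : VecIdx n) :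
    (l.map simpleRefl).prod.1 (vecWt a) = vecWt (wordVec l a) := by
  induction l with
  | nil => rfl
  | cons i l ih =>
    rw [List.map_cons, List.prod_cons, wordVec_cons, Equiv.Perm.mul_apply, vecWt_reflVec, ← ih]
    rfl

theorem vecWt_injective : Function.Injective (vecWt : VecIdx n → Weight n) := by
  have hpos (p : Fin n) : 0 < eps p p := by
    simp only [eps, if_true]
    split_ifs <;> norm_num
  have hzero {p q : Fin n} (hpq : p < q) : eps p q = 0 := by
    simp only [eps, Fin.ext_iff, Fin.lt_def] at hpq ⊢
    split_ifs <;> omega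
  have hne {p q : Fin n} (h : eps p = eps q ∨ eps p = -eps q) : p = q := by
    have hp : eps p p = eps q p ∨ eps p p = -eps q p := h.imp (congrFun · p) (congrFun · p)
    have hq : eps p q = eps q q ∨ eps p q = -eps q q := h.imp (congrFun · q) (congrFun · q)
    have := hpos p
    have := hpos q
    rcases lt_trichotomy p q with hlt | rfl | hlt
    · have := hzero hlt
      omega
    · rfl
    · have := hzero hlt
      omega
  have hne_zero (p : Fin n) : eps p ≠ 0 := fun h => (hpos p).ne' (congrFun h p)
  have hne_neg (p q : Fin n) : eps p ≠ -eps q := fun h => by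
    obtain rfl := hne (.inr h)
    exact hne_zero p (self_eq_neg.1 h)
  rintro (p | _ | p) (q | _ | q) h <;> simp only [vecWt, neg_inj] at h
  · rw [hne (.inl h)]
  · exact absurd h (hne_zero p)
  · exact absurd h (hne_neg p q)
  · exact absurd h.symm (hne_zero q)
  · rfl
  · exact absurd (neg_eq_zero.1 h.symm) (hne_zero q)
  · exact absurd h.symm (hne_neg q p)
  · exact absurd (neg_eq_zero.1 h) (hne_zero p)
  · rw [hne (.inl h)]

theorem ext_vecWt {w w' : Weyl n} (h : ∀ a, w.1 (vecWt a) = w'.1 (vecWt a)) : w = w' := by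
  refine Subtype.ext (LinearEquiv.toLinearMap_injective (LinearMap.pi_ext' fun k => ?_))
  refine LinearMap.ext_ring ?_
  change w.1 (fundWeight k) = w'.1 (fundWeight k)
  refine smul_right_injective _ (show (if k.val + 1 = n then 2 else 1 : ℤ) ≠ 0 by
    split_ifs <;> simp) ?_
  simp only [← map_zsmul, ← sum_eps_castLE, map_sum]
  exact Finset.sum_congr rfl fun p _ => h (.inl _)

theorem prod_map_simpleRefl_eq_iff {l l' : List (Fin n)} :
    (l.map simpleRefl).prod = (l'.map simpleRefl).prod ↔ wordVec l = wordVec l' := by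
  refine ⟨fun h => Equiv.ext fun a => vecWt_injective ?_, fun h => ext_vecWt fun a => ?_⟩
  · rw [← prod_map_simpleRefl_vecWt, h, prod_map_simpleRefl_vecWt]
  · rw [prod_map_simpleRefl_vecWt, h, prod_map_simpleRefl_vecWt]

theorem weylLength_le {l : List (Fin n)} {w : Weyl n} (h : (l.map simpleRefl).prod = w) :
    weylLength w ≤ l.length :=
  Nat.sInf_le ⟨l, h, rfl⟩

theorem IsReducedWord.isReduced {l : List (Fin n)} {w : Weyl n} (h : IsReducedWord l w) :
    IsReduced l := fun l' hl' => by
  rw [h.2]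
  exact weylLength_le ((prod_map_simpleRefl_eq_iff.2 hl').trans h.1)

theorem IsReducedWord.eq_singleton {l : List (Fin n)} {i : Fin n}
    (h : IsReducedWord l (simpleRefl i)) : l = [i] := by
  have hlen : l.length ≤ 1 := by
    rw [h.2]
    exact weylLength_le (l := [i]) (by simp)
  have hi := congrArg (fun w : Weyl n => w.1 (fundWeight i) i) h.1
  have hrefl (j : Fin n) : reflectionMap j (fundWeight i) i = if i = j then -1 else 1 := by
    rcases eq_or_ne i j with rfl | hij
    · simp [reflectionMap_apply_self, fundWeight]
    · simp [reflectionMap_apply, fundWeight, hij, hij.symm]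
  match l, hlen with
  | [], _ =>
    change fundWeight i i = reflectionMap i (fundWeight i) i at hi
    rw [hrefl, if_pos rfl] at hi
    simp [fundWeight] at hi
  | [j], _ =>
    change reflectionMap j (fundWeight i) i = reflectionMap i (fundWeight i) i at hi
    simpa [hrefl, eq_comm] using hi

theorem IsLongest.isDescent {w : Weyl n} (hw : IsLongest w) {l : List (Fin n)}
    (hl : IsReducedWord l w) (i : Fin n) : IsDescent i (wordVec l) := by
  obtain ⟨l₁, hl₁⟩ := exists_reducedWord (simpleRefl i * w)
  have hword : wordVec l₁ = reflVec i * wordVec l := by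
    rw [← wordVec_cons, ← prod_map_simpleRefl_eq_iff, List.map_cons, List.prod_cons, hl₁.1, hl.1]
  by_contra hi
  have hi₁ : IsDescent i (wordVec l₁) := by
    have hne : (wordVec l)⁻¹ (reflVec i (.inl i)) ≠ (wordVec l)⁻¹ (.inl i) :=
      (wordVec l)⁻¹.injective.ne (ne_of_apply_ne level (level_reflVec_inl_lt i).ne)
    rw [IsDescent, hword, _root_.mul_inv_rev, reflVec_inv, Equiv.Perm.mul_apply,
      Equiv.Perm.mul_apply, reflVec_involutive]
    exact lt_of_le_of_ne (not_lt.1 hi) (level_injective.ne hne)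
  obtain ⟨l₂, hlen, hl₂⟩ := hi₁.exists_wordVec_eq_reflVec_mul
  rw [hword, ← mul_assoc, reflVec_mul_self, one_mul] at hl₂
  have h₁ : l₁.length ≤ l.length := by
    rw [hl₁.2, hl.2]
    exact hw _
  exact (hl.isReduced l₂ hl₂).not_gt (hlen.trans_le h₁)

theorem wordVec_inl_of_isDescent {π : Equiv.Perm (VecIdx n)} (hbar : ∀ a, π (bar a) = bar (π a))
    (hπ : ∀ i, IsDescent i π) (p : Fin n) : π (.inl p) = .inr (.inr p) := by
  cases n with
  | zero => exact p.elim0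
  | succ n =>
    have hmono : StrictMono fun p => level (π⁻¹ (.inl p)) :=
      Fin.strictMono_iff_lt_succ.2 fun i => by
        have hi := hπ i.castSucc
        rwa [IsDescent, reflVec_of_lt (i := i.castSucc) (by simp), Equiv.sumCongr_apply,
          Sum.map_inl, Equiv.swap_apply_left] at hi
    have hneg (p) : level (π⁻¹ (.inl p)) < 0 := by
      have hlast := hπ (Fin.last n)
      rw [IsDescent, reflVec_of_last (i := Fin.last n) rfl, Equiv.swap_apply_left] at hlast
      have hle := hmono.monotone (Fin.le_last p)
      have hlevel : level (π⁻¹ (.inr (.inr (Fin.last n)))) = -level (π⁻¹ (.inl (Fin.last n))) := by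
        rw [← level_bar, ← inv_apply_bar hbar, bar]
      omega
    have hinr (p) : ∃ q, π⁻¹ (.inl p) = .inr (.inr q) := by
      have := hneg p
      rcases hp : π⁻¹ (.inl p) with q | _ | q
      · simp only [hp, level] at this
        omega
      · simp [hp, level] at this
      · exact ⟨q, rfl⟩
    choose σ hσ using hinr
    have hσmono : StrictMono σ := fun p q hpq => by
      simpa [hσ, level] using hmono hpq
    have hσid : σ = id := by
      rw [← hσmono.range_inj strictMono_id, Set.range_id]
      exact (Finite.surjective_of_injective hσmono.injective).range_eq
    have h : π (.inr (.inr p)) = .inl p := by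
      rw [← Equiv.Perm.eq_inv_iff_eq, hσ, hσid, id]
    simpa [h, bar] using hbar (.inr (.inr p))

end ReducedWords

/-! ### The representatives of Weyl group elements -/

section Lifts

variable {n : ℕ}

theorem signedSwap_apply_left {x y : VecIdx n} (hx : level x ≠ 0) :
    signedSwap x y x = y := by
  have hbar : x ≠ bar x := fun h => hx (self_eq_neg.1 ((congrArg level h).trans (level_bar x)))
  rw [signedSwap]
  split_ifs with h
  · exact Equiv.swap_apply_left x y
  · have hbar' : x ≠ bar y := fun h' => h (by rw [h', bar_bar])
    rw [Equiv.Perm.mul_apply, Equiv.swap_apply_of_ne_of_ne hbar hbar', Equiv.swap_apply_left]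

theorem level_reflVec_lt_iff {i : Fin n} {x y : VecIdx n} (hx : level x ≠ 0) (hy : level y ≠ 0)
    (h : x ≠ reflVec i y) :
    level (reflVec i x) < level (reflVec i y) ↔ level x < level y := by
  have hx' : level (reflVec i x) ≠ 0 := level_apply_ne_zero (reflVec_bar i) hx
  have hy' : level (reflVec i y) ≠ 0 := level_apply_ne_zero (reflVec_bar i) hy
  constructor <;> intro hlt <;> by_contra hle
  · have hswap : signedSwap (reflVec i y) (reflVec i x) = reflVec i :=
      signedSwap_eq_reflVec hy' hx' hlt (by simpa only [reflVec_involutive i _] using not_lt.1 hle)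
    have heq := signedSwap_apply_left (y := reflVec i x) hy'
    rw [hswap, reflVec_involutive] at heq
    exact h (by rw [heq, reflVec_involutive])
  · have heq := signedSwap_apply_left (y := x) hy
    rw [signedSwap_eq_reflVec hy hx hlt (not_lt.1 hle)] at heq
    exact h heq.symm

theorem reflVec_eq_self {i : Fin n} {x : VecIdx n} (hx : vecWt x i = 0) : reflVec i x = x :=
  vecWt_injective (by rw [vecWt_reflVec, reflectionMap_apply, hx, zero_smul, sub_zero])

theorem reflVec_eq_bar_of_last {i : Fin n} (h : i.val + 1 = n) {x : VecIdx n}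
    (hx : vecWt x i ≠ 0) : reflVec i x = bar x := by
  rw [reflVec_of_last h]
  rcases x with p | _ | p
  · obtain rfl : p = i := by
      by_contra hp
      exact hx (by simp only [vecWt, eps, Fin.ext_iff] at hp ⊢; split_ifs <;> omega)
    exact Equiv.swap_apply_left _ _
  · exact absurd rfl hx
  · obtain rfl : p = i := by
      by_contra hp
      exact hx (by simp only [vecWt, eps, Fin.ext_iff, Pi.neg_apply] at hp ⊢; split_ifs <;> omega)
    exact Equiv.swap_apply_right _ _

theorem eq_reflVec_inl_or_eq_bar_inl {i : Fin n} {x : VecIdx n} (hx : vecWt x i < 0) :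
    x = reflVec i (.inl i) ∨ x = bar (.inl i) := by
  rcases x with p | _ | p <;> simp only [vecWt, eps, Pi.neg_apply] at hx
  · left
    obtain hp : i.val + 1 = p.val := by
      split_ifs at hx <;> omega
    rw [reflVec_of_lt (by omega), Equiv.sumCongr_apply, Sum.map_inl, Equiv.swap_apply_left]
    exact congrArg Sum.inl (Fin.ext hp.symm)
  · exact absurd hx (lt_irrefl 0)
  · right
    obtain rfl : i = p := by
      split_ifs at hx <;> first | assumption | omega
    rfl

theorem level_lt_level_reflVec {i : Fin n} {x : VecIdx n} (hx : vecWt x i < 0) :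
    level x < level (reflVec i x) := by
  rcases eq_reflVec_inl_or_eq_bar_inl hx with rfl | rfl
  · rw [reflVec_involutive]
    exact level_reflVec_inl_lt i
  · rw [reflVec_bar, level_bar, level_bar]
    exact neg_lt_neg (level_reflVec_inl_lt i)

theorem level_inv_lt_of_not_isDescent {i : Fin n} {π : Equiv.Perm (VecIdx n)}
    (hπ : ∀ a, π (bar a) = bar (π a)) (h : ¬IsDescent i π) {x : VecIdx n} (hx : vecWt x i < 0) :
    level (π⁻¹ x) < level (π⁻¹ (reflVec i x)) := by
  have hlt : level (π⁻¹ (reflVec i (.inl i))) < level (π⁻¹ (.inl i)) :=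
    lt_of_le_of_ne (not_lt.1 h) (level_injective.ne (π⁻¹.injective.ne
      (ne_of_apply_ne level (level_reflVec_inl_lt i).ne)))
  rcases eq_reflVec_inl_or_eq_bar_inl hx with rfl | rfl
  · rwa [reflVec_involutive]
  · rw [reflVec_bar, inv_apply_bar hπ, inv_apply_bar hπ, level_bar, level_bar]
    exact neg_lt_neg hlt

/-- The sign of the coefficient of `v_{π(j)}` in `\bar w v_j`, where `π` is the permutation by which
`w` acts. -/
def liftSign (π : Equiv.Perm (VecIdx n)) (j : Fin n) : ℂ :=
  ∏ a ∈ Finset.Iio j, if level (π (.inl a)) < level (π (.inl j)) then -1 else 1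

theorem exists_apply_inl_eq_reflVec {i : Fin n} {π : Equiv.Perm (VecIdx n)}
    (hπ : ∀ a, π (bar a) = bar (π a)) (h : ¬IsDescent i π) {j : Fin n}
    (hj : vecWt (π (.inl j)) i < 0) : ∃ b, π (.inl b) = reflVec i (π (.inl j)) ∧ b < j := by
  have hlt := level_inv_lt_of_not_isDescent hπ h hj
  rw [show π⁻¹ (π (.inl j)) = .inl j from π.symm_apply_apply _] at hlt
  rcases hb : π⁻¹ (reflVec i (π (.inl j))) with b | _ | b <;> rw [hb] at hlt <;>
    simp only [level] at hlt
  · exact ⟨b, (Equiv.Perm.inv_eq_iff_eq.1 hb).symm, by omega⟩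
  · omega
  · omega

theorem apply_inl_ne_reflVec {i : Fin n} {π : Equiv.Perm (VecIdx n)}
    (hπ : ∀ a, π (bar a) = bar (π a)) (h : ¬IsDescent i π) {a j : Fin n}
    (hj : vecWt (π (.inl j)) i ≠ -1) (ha : a < j) : π (.inl a) ≠ reflVec i (π (.inl j)) := by
  intro heq
  rcases lt_trichotomy (vecWt (π (.inl j)) i) 0 with hwt | hwt | hwt
  · have hlast : i.val + 1 = n := (succ_lt_or_succ_eq i).resolve_left fun hi => by
      have := abs_le.1 (abs_vecWt_le_of_lt hi (π (.inl j)))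
      omega
    rw [reflVec_eq_bar_of_last hlast hwt.ne, ← hπ] at heq
    exact Sum.inl_ne_inr (π.injective heq)
  · rw [reflVec_eq_self hwt] at heq
    exact ha.ne (Sum.inl_injective (π.injective heq))
  · have hlt := level_inv_lt_of_not_isDescent hπ h (x := π (.inl a))
      (by rw [heq, vecWt_reflVec_self]; omega)
    rw [show π⁻¹ (π (.inl a)) = .inl a from π.symm_apply_apply _, heq, reflVec_involutive,
      show π⁻¹ (π (.inl j)) = .inl j from π.symm_apply_apply _] at hlt
    simp only [level] at hlt
    omega

theorem liftSign_reflVec_mul {i : Fin n} {π : Equiv.Perm (VecIdx n)}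
    (hπ : ∀ a, π (bar a) = bar (π a)) (h : ¬IsDescent i π) (j : Fin n) :
    liftSign (reflVec i * π) j =
      liftSign π j * if vecWt (π (.inl j)) i = -1 then -1 else 1 := by
  have hne (a : Fin n) : level (π (.inl a)) ≠ 0 :=
    level_apply_ne_zero hπ (by simp only [level]; omega)
  have hterm {a : Fin n} (ha : π (.inl a) ≠ reflVec i (π (.inl j))) :
      (if level ((reflVec i * π) (.inl a)) < level ((reflVec i * π) (.inl j)) then -1 else 1 : ℂ) =
        if level (π (.inl a)) < level (π (.inl j)) then -1 else 1 :=
    if_congr (level_reflVec_lt_iff (hne a) (hne j) ha) rfl rfl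
  simp only [liftSign]
  split_ifs with hwt
  · have hlt : vecWt (π (.inl j)) i < 0 := by omega
    obtain ⟨b, hb, hbj⟩ := exists_apply_inl_eq_reflVec hπ h hlt
    rw [← Finset.mul_prod_erase _ _ (Finset.mem_Iio.2 hbj),
      ← Finset.mul_prod_erase _ _ (Finset.mem_Iio.2 hbj),
      Finset.prod_congr rfl fun a ha => hterm ?_]
    · have hlevel := level_lt_level_reflVec hlt
      rw [Equiv.Perm.mul_apply, Equiv.Perm.mul_apply, hb, reflVec_involutive, if_pos hlevel,
        if_neg hlevel.not_gt]
      ring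
    · rw [← hb]
      exact π.injective.ne (Sum.inl_injective.ne (Finset.ne_of_mem_erase ha))
  · rw [mul_one]
    exact Finset.prod_congr rfl fun a ha => hterm
      (apply_inl_ne_reflVec hπ h hwt (Finset.mem_Iio.1 ha))

theorem vecWt_ne_neg_one_of_last {i : Fin n} (h : i.val + 1 = n) (a : VecIdx n) :
    vecWt a i ≠ -1 := by
  rcases a with p | _ | p <;> simp only [vecWt, eps, Pi.neg_apply, Pi.zero_apply]
  · split_ifs <;> omega
  · omega
  · split_ifs <;> omega

theorem vecRep_sBar_inv_mulVec (i : Fin n) (f : VecIdx n → ℂ) {a : VecIdx n} (ha : level a ≠ 0) :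
    (vecRep (sBar i)⁻¹ *ᵥ f) a = (if vecWt a i = -1 then -1 else 1) * f (reflVec i a) := by
  have hrep : vecRep (sBar i)⁻¹ = _ := congrArg Prod.fst (rep_sBar_inv i)
  rw [hrep]
  change (vecRankOne i _ *ᵥ f) a = _
  rcases succ_lt_or_succ_eq i with h | h
  · rw [vecRankOne_mulVec_of_lt h]
    have hle := abs_le.1 (abs_vecWt_le_of_lt h a)
    obtain hwt | hwt | hwt : vecWt a i = 1 ∨ vecWt a i = -1 ∨ vecWt a i = 0 := by omega
    · simp [hwt]
    · simp [hwt]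
    · simp [hwt, reflVec_eq_self hwt]
  · rw [vecRankOne_mulVec_of_last h, if_neg (vecWt_ne_neg_one_of_last h a), one_mul]
    rcases a with p | _ | p
    · simp only [reflVec_of_last h, Equiv.swap_apply_def]
      split_ifs <;> simp_all
    · exact absurd rfl ha
    · simp only [reflVec_of_last h, Equiv.swap_apply_def]
      split_ifs <;> simp_all

theorem vecRep_wordLift_inv_mulVec_inl {l : List (Fin n)} (hl : IsReduced l) (f : VecIdx n → ℂ)
    (j : Fin n) : (vecRep (l.map sBar).prod⁻¹ *ᵥ f) (.inl j) =
      liftSign (wordVec l) j * f (wordVec l (.inl j)) := by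
  induction l generalizing f with
  | nil =>
    have hsign : liftSign (wordVec []) j = 1 := Finset.prod_eq_one fun a ha => if_neg (by
      have := Finset.mem_Iio.1 ha
      simp only [wordVec, List.map_nil, List.prod_nil, Equiv.Perm.one_apply, level]
      omega)
    rw [hsign]
    simp [wordVec]
  | cons i l ih =>
    rw [List.map_cons, List.prod_cons, _root_.mul_inv_rev, map_mul, ← Matrix.mulVec_mulVec,
      ih hl.of_cons, vecRep_sBar_inv_mulVec, wordVec_cons,
      liftSign_reflVec_mul (wordVec_bar l) hl.not_isDescent, mul_assoc]
    · rfl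
    · exact level_apply_ne_zero (wordVec_bar l) (by simp only [level]; omega)

/-- The signs of the weight `w Λ_n` of the spin representation, where `π` is the permutation by
which `w` acts on the basis of the vector representation. -/
def spinSigns (π : Equiv.Perm (VecIdx n)) : SpinIdx n := fun p => decide (0 < level (π⁻¹ (.inl p)))

theorem spinSigns_reflVec_mul {π : Equiv.Perm (VecIdx n)} (hπ : ∀ a, π (bar a) = bar (π a))
    (i : Fin n) : spinSigns (reflVec i * π) = spinRefl i (spinSigns π) := by
  funext p
  have hinv : (reflVec i * π)⁻¹ (.inl p) = π⁻¹ (reflVec i (.inl p)) := by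
    rw [_root_.mul_inv_rev, reflVec_inv, Equiv.Perm.mul_apply]
  rw [spinSigns, hinv]
  rcases succ_lt_or_succ_eq i with h | h
  · rw [reflVec_of_lt h, spinRefl_of_lt h]
    rfl
  · rw [spinRefl_of_last h, reflVec_of_last h]
    rcases eq_or_ne p i with rfl | hp
    · have hbar : π⁻¹ (.inr (.inr p)) = bar (π⁻¹ (.inl p)) := inv_apply_bar hπ (.inl p)
      have hne : level (π⁻¹ (.inl p)) ≠ 0 :=
        level_apply_ne_zero (inv_apply_bar hπ) (by simp only [level]; omega)
      rw [Equiv.swap_apply_left, Function.update_self, spinSigns, hbar, level_bar, ← decide_not]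
      exact decide_eq_decide.2 (by omega)
    · rw [Equiv.swap_apply_of_ne_of_ne (by simpa using hp) (by simp), Function.update_of_ne hp]
      rfl

theorem spinWt_spinSigns_ne_of_not_isDescent {i : Fin n} {π : Equiv.Perm (VecIdx n)}
    (hπ : ∀ a, π (bar a) = bar (π a)) (h : ¬IsDescent i π) : spinWt (spinSigns π) i ≠ -1 := by
  intro hwt
  have hbool : ∀ a b : Bool, a.toInt - b.toInt = -1 → a = false ∧ b = true := by decide
  obtain ⟨hlow, hhigh⟩ := hbool _ _ hwt
  simp only [spinSigns, decide_eq_false_iff_not, not_lt] at hlow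
  refine h ?_
  rw [IsDescent]
  rcases succ_lt_or_succ_eq i with hi | hi
  · rw [dif_pos hi, spinSigns, decide_eq_true_iff] at hhigh
    rw [reflVec_of_lt hi, Equiv.sumCongr_apply, Sum.map_inl, Equiv.swap_apply_left]
    exact hlow.trans_lt hhigh
  · have hbar : π⁻¹ (reflVec i (.inl i)) = bar (π⁻¹ (.inl i)) := by
      rw [reflVec_of_last hi, Equiv.swap_apply_left]
      exact inv_apply_bar hπ (.inl i)
    have hne : level (π⁻¹ (.inl i)) ≠ 0 :=
      level_apply_ne_zero (inv_apply_bar hπ) (by simp only [level]; omega)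
    rw [hbar, level_bar]
    omega

theorem spinRefl_eq_self {i : Fin n} {s : SpinIdx n} (hs : spinWt s i = 0) :
    spinRefl i s = s := by
  rcases succ_lt_or_succ_eq i with h | h
  · have heq : s i = s ⟨i.val + 1, h⟩ := by
      simp only [spinWt, dif_pos h] at hs
      cases hi : s i <;> cases hj : s ⟨i.val + 1, h⟩ <;> simp_all
    rw [spinRefl_of_lt h]
    funext p
    rw [Function.comp_apply, Equiv.swap_apply_def]
    split_ifs <;> simp_all
  · simp only [spinWt, dif_neg h.not_lt] at hs
    cases hi : s i <;> simp [hi] at hs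

theorem spinRep_sBar_inv_mulVec {i : Fin n} (f : SpinIdx n → ℂ) {s : SpinIdx n}
    (hs : spinWt s i ≠ -1) : (spinRep (sBar i)⁻¹ *ᵥ f) s = f (spinRefl i s) := by
  have hrep : spinRep (sBar i)⁻¹ = _ := congrArg Prod.snd (rep_sBar_inv i)
  rw [hrep]
  change (spinRankOne i _ *ᵥ f) s = _
  rw [spinRankOne_mulVec, if_neg hs]
  split_ifs with hwt
  · simp
  · have := abs_le.1 (abs_spinWt_le s i)
    rw [spinRefl_eq_self (by omega)]

theorem spinRep_wordLift_inv_mulVec_top {l : List (Fin n)} (hl : IsReduced l)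
    (f : SpinIdx n → ℂ) :
    (spinRep (l.map sBar).prod⁻¹ *ᵥ f) ⊤ = f (spinSigns (wordVec l)) := by
  induction l generalizing f with
  | nil =>
    have hsigns : spinSigns (wordVec []) = (⊤ : SpinIdx n) := funext fun p => by
      simp [spinSigns, wordVec, level]
    simp [hsigns]
  | cons i l ih =>
    rw [List.map_cons, List.prod_cons, _root_.mul_inv_rev, map_mul, ← Matrix.mulVec_mulVec,
      ih hl.of_cons, spinRep_sBar_inv_mulVec, wordVec_cons, spinSigns_reflVec_mul (wordVec_bar l)]
    exact spinWt_spinSigns_ne_of_not_isDescent (wordVec_bar l) hl.not_isDescent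

theorem weylLift_simpleRefl (i : Fin n) : weylLift (simpleRefl i) = sBar i := by
  rw [weylLift, (exists_reducedWord (simpleRefl i)).choose_spec.eq_singleton]
  simp

theorem IsLongest.vecRep_weylLift_inv_mulVec_inl {w : Weyl n} (hw : IsLongest w)
    (f : VecIdx n → ℂ) (j : Fin n) :
    (vecRep (weylLift w)⁻¹ *ᵥ f) (.inl j) = (-1) ^ j.val * f (.inr (.inr j)) := by
  have hl := (exists_reducedWord w).choose_spec
  have hinl := wordVec_inl_of_isDescent (wordVec_bar _) (hw.isDescent hl)
  rw [weylLift, vecRep_wordLift_inv_mulVec_inl hl.isReduced, liftSign]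
  simp only [hinl]
  rw [Finset.prod_congr rfl fun a ha => if_pos ?_]
  · simp
  · have := Finset.mem_Iio.1 ha
    simpa [level] using this

theorem IsLongest.spinRep_weylLift_inv_mulVec_top {w : Weyl n} (hw : IsLongest w)
    (f : SpinIdx n → ℂ) : (spinRep (weylLift w)⁻¹ *ᵥ f) ⊤ = f ⊥ := by
  have hl := (exists_reducedWord w).choose_spec
  have hinl := wordVec_inl_of_isDescent (wordVec_bar _) (hw.isDescent hl)
  rw [weylLift, spinRep_wordLift_inv_mulVec_top hl.isReduced]
  congr 1
  funext p
  have hp : (wordVec (exists_reducedWord w).choose)⁻¹ (.inl p) = .inr (.inr p) := by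
    rw [Equiv.Perm.inv_eq_iff_eq]
    exact ((wordVec_bar _ (.inl p)).trans (congrArg bar (hinl p))).symm
  simp [spinSigns, hp, level]

end Lifts

/-! ### The vector representation of `Θ⁻` -/

section Theta

variable {n : ℕ}

/-- The product `∏_{i ≤ j} y_i(d_i) α_i^∨(d_i⁻¹)`, an initial part of a row of `Θ⁻`. -/
noncomputable def rowInit {j : ℕ} (d : ℕ → ℂˣ) (hj : j ≤ n) : G n :=
  (List.ofFn fun i : Fin j => yBold (i.castLE hj) (d (i.val + 1))).prod

theorem rowInit_zero (d : ℕ → ℂˣ) : rowInit d (Nat.zero_le n) = 1 := rfl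

theorem rowInit_succ {j : ℕ} (d : ℕ → ℂˣ) (hj : j < n) :
    rowInit d hj = rowInit d hj.le * yBold ⟨j, hj⟩ (d (j + 1)) := by
  rw [rowInit, List.ofFn_succ', List.concat_eq_append, List.prod_append, List.prod_singleton]
  rfl

/-- A row `∏_i y_i(d_i) α_i^∨(d_i⁻¹)` of `Θ⁻`. -/
noncomputable def row (d : ℕ → ℂˣ) : G n := rowInit d le_rfl

/-- The product of the rows `m + 1, …, m + k` of `Θ⁻`. -/
noncomputable def thetaRows (c : ℕ → ℕ → ℂˣ) (m k : ℕ) : G n :=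
  (List.ofFn fun p : Fin k => row (c (m + p.val + 1))).prod

theorem thetaRows_zero (c : ℕ → ℕ → ℂˣ) (m : ℕ) : (thetaRows c m 0 : G n) = 1 := rfl

theorem thetaRows_succ (c : ℕ → ℕ → ℂˣ) (m k : ℕ) :
    (thetaRows c m (k + 1) : G n) = row (c (m + 1)) * thetaRows c (m + 1) k := by
  simp only [thetaRows, List.ofFn_succ, List.prod_cons, Fin.val_zero, Fin.val_succ, add_assoc,
    add_comm 1]

theorem thetaMinus_wordZero (c : ℕ → ℕ → ℂˣ) : thetaMinus (wordZero n c) = thetaRows c 0 n := by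
  simp only [thetaMinus, wordZero, thetaRows, row, rowInit, List.map_flatten, List.prod_flatten,
    List.map_ofFn, Function.comp_def, zero_add]
  rfl

theorem vecRep_yBold (i : Fin n) (c : ℂˣ) :
    vecRep (yBold i c) = vecRankOne i !![(c : ℂ)⁻¹, 0; 1, c] :=
  congrArg Prod.fst (rep_yBold i c)

theorem vecRep_mul_mulVec (g h : G n) (f : VecIdx n → ℂ) :
    vecRep (g * h) *ᵥ f = vecRep g *ᵥ (vecRep h *ᵥ f) := by
  rw [map_mul, Matrix.mulVec_mulVec]

/-- The coordinate of `f` at the predecessor of `v_p` in `v_1, …, v_n`, and `0` if `p = 1`. -/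
def predCoord (f : VecIdx n → ℂ) (p : Fin n) : ℂ :=
  if p.val = 0 then 0 else f (.inl ⟨p.val - 1, by omega⟩)

theorem vecRep_rowInit_mulVec_inl {d : ℕ → ℂˣ} (hd : d 0 = 1) {j : ℕ} (hj : j < n)
    (f : VecIdx n → ℂ) (p : Fin n) :
    (vecRep (rowInit d hj.le) *ᵥ f) (.inl p) =
      if p.val < j then predCoord f p + d p / d (p + 1) * f (.inl p)
      else if p.val = j then predCoord f p + d p * f (.inl p)
      else f (.inl p) := by
  induction j generalizing f with
  | zero =>
    rw [rowInit_zero, map_one, Matrix.one_mulVec, if_neg (Nat.not_lt_zero _)]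
    split_ifs with hp
    · simp [predCoord, hp, hd]
    · rfl
  | succ j ih =>
    rw [rowInit_succ d (by omega), vecRep_mul_mulVec, ih (by omega)]
    have hg := vecRankOne_mulVec_inl_of_lt (i := ⟨j, by omega⟩) hj !![(d (j + 1) : ℂ)⁻¹, 0; 1,
      d (j + 1)] f
    simp only [Matrix.of_apply, Matrix.cons_val', Matrix.cons_val_zero, Matrix.cons_val_one,
      Matrix.cons_val_fin_one, zero_mul, add_zero, one_mul] at hg
    simp only [predCoord, vecRep_yBold, hg]
    rcases lt_trichotomy p.val (j + 1) with hp | hp | hp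
    · rcases Nat.lt_succ_iff_lt_or_eq.1 hp with hp | rfl
      · simp [hp, hp.ne, hp.trans (Nat.lt_succ_self j), (Nat.sub_lt_of_lt hp).ne,
          show p.val - 1 ≠ j + 1 by omega, show p.val ≠ j + 1 by omega]
      · simp only [lt_self_iff_false, ↓reduceIte, Fin.eta, show p.val - 1 ≠ p.val + 1 by omega,
          lt_add_iff_pos_right, Order.lt_one_iff]
        grind
    · obtain rfl : p = ⟨j + 1, hj⟩ := Fin.ext hp
      simp
    · simp [hp.ne', hp.not_gt, show ¬ p.val < j by omega, show p.val ≠ j by omega]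

theorem vecRep_rowInit_mulVec_mid (d : ℕ → ℂˣ) {j : ℕ} (hj : j < n) (f : VecIdx n → ℂ) :
    (vecRep (rowInit d hj.le) *ᵥ f) (.inr (.inl ())) = f (.inr (.inl ())) := by
  induction j generalizing f with
  | zero => rw [rowInit_zero, map_one, Matrix.one_mulVec]
  | succ j ih =>
    rw [rowInit_succ d (by omega), vecRep_mul_mulVec, ih (by omega), vecRep_yBold,
      vecRankOne_mulVec_mid_of_lt hj]

theorem vecRep_rowInit_mulVec_inr {d : ℕ → ℂˣ} (hd : d 0 = 1) {j : ℕ} (hj : j < n)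
    (f : VecIdx n → ℂ) (p : Fin n) :
    (vecRep (rowInit d hj.le) *ᵥ f) (.inr (.inr p)) =
      if p.val ≤ j then
        (d p : ℂ)⁻¹ * (∑ b ∈ Finset.Ico p ⟨j, hj⟩, d (b + 1) * f (.inr (.inr b))
          + f (.inr (.inr ⟨j, hj⟩)))
      else f (.inr (.inr p)) := by
  induction j generalizing f with
  | zero =>
    rw [rowInit_zero, map_one, Matrix.one_mulVec]
    split_ifs with hp
    · obtain rfl : p = ⟨0, hj⟩ := Fin.ext (Nat.le_zero.1 hp)
      simp [hd]
    · rfl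
  | succ j ih =>
    rw [rowInit_succ d (by omega), vecRep_mul_mulVec, ih (by omega)]
    have hg := vecRankOne_mulVec_inr_of_lt (i := ⟨j, by omega⟩) hj !![(d (j + 1) : ℂ)⁻¹, 0; 1,
      d (j + 1)] f
    simp only [Matrix.of_apply, Matrix.cons_val', Matrix.cons_val_zero, Matrix.cons_val_one,
      Matrix.cons_val_fin_one, zero_mul, add_zero, one_mul] at hg
    simp only [vecRep_yBold, hg]
    rcases lt_trichotomy p.val (j + 1) with hp | hp | hp
    · have hIco : Finset.Ico p ⟨j + 1, hj⟩ = Finset.Icc p ⟨j, by omega⟩ := by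
        ext b
        simp only [Finset.mem_Ico, Finset.mem_Icc, Fin.le_def, Fin.lt_def, Nat.lt_succ_iff]
      rw [hIco, ← Finset.sum_Ico_add_eq_sum_Icc (Fin.le_def.2 (Nat.lt_succ_iff.1 hp)), if_pos hp.le,
        if_pos (Nat.lt_succ_iff.1 hp)]
      have hsum : ∀ b ∈ Finset.Ico p ⟨j, by omega⟩, b.val ≠ j ∧ b.val ≠ j + 1 := fun b hb => by
        have := Fin.lt_def.1 (Finset.mem_Ico.1 hb).2
        grind
      rw [Finset.sum_congr rfl fun b hb => by rw [if_neg (hsum b hb).1, if_neg (hsum b hb).2]]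
      simp only [↓reduceIte]
      ring
    · obtain rfl : p = ⟨j + 1, hj⟩ := Fin.ext hp
      simp
    · simp [hp.not_ge, hp.ne', show ¬ p.val ≤ j by omega, show p.val ≠ j by omega]

theorem row_eq_mul_yBold {i : Fin n} (h : i.val + 1 = n) (d : ℕ → ℂˣ) :
    row d = rowInit d i.isLt.le * yBold i (d n) := by
  obtain ⟨i, hi⟩ := i
  obtain rfl : i + 1 = n := h
  exact rowInit_succ d hi

theorem vecRep_row_mulVec_inl_of_lt {d : ℕ → ℂˣ} (hd : d 0 = 1) {p : Fin n} (hp : p.val + 1 < n)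
    (f : VecIdx n → ℂ) :
    (vecRep (row d) *ᵥ f) (.inl p) = predCoord f p + d p / d (p + 1) * f (.inl p) := by
  obtain ⟨i, hi⟩ : ∃ i : Fin n, i.val + 1 = n := ⟨⟨n - 1, by omega⟩, by simp; omega⟩
  rw [row_eq_mul_yBold hi, vecRep_mul_mulVec, vecRep_rowInit_mulVec_inl hd i.isLt,
    if_pos (by omega), vecRep_yBold]
  have hpi : p ≠ i := by omega
  have hpi' : (⟨p.val - 1, by omega⟩ : Fin n) ≠ i := by simp [Fin.ext_iff]; omega
  simp [predCoord, vecRankOne_mulVec_of_last hi, hpi, hpi']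

theorem vecRep_row_mulVec_inl_of_last {d : ℕ → ℂˣ} (hd : d 0 = 1) {i : Fin n} (hi : i.val + 1 = n)
    (f : VecIdx n → ℂ) :
    (vecRep (row d) *ᵥ f) (.inl i) = predCoord f i + d i / d n ^ 2 * f (.inl i) := by
  rw [row_eq_mul_yBold hi, vecRep_mul_mulVec, vecRep_rowInit_mulVec_inl hd i.isLt,
    if_neg (lt_irrefl _), if_pos rfl, vecRep_yBold]
  have hi' (h : i.val ≠ 0) : (⟨i.val - 1, by omega⟩ : Fin n) ≠ i := by simp [Fin.ext_iff]; omega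
  by_cases h : i.val = 0
  · simp [predCoord, vecRankOne_mulVec_of_last hi, h, div_eq_mul_inv, mul_assoc]
  · simp [predCoord, vecRankOne_mulVec_of_last hi, h, hi' h, div_eq_mul_inv, mul_assoc]

theorem vecRep_row_mulVec_mid (d : ℕ → ℂˣ) {i : Fin n} (hi : i.val + 1 = n) (f : VecIdx n → ℂ) :
    (vecRep (row d) *ᵥ f) (.inr (.inl ())) = f (.inr (.inl ())) + (d n : ℂ)⁻¹ * f (.inl i) := by
  rw [row_eq_mul_yBold hi, vecRep_mul_mulVec, vecRep_rowInit_mulVec_mid d i.isLt, vecRep_yBold,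
    vecRankOne_mulVec_of_last hi]
  simp [add_comm]

theorem vecRep_row_mulVec_inr {d : ℕ → ℂˣ} (hd : d 0 = 1) {i : Fin n} (hi : i.val + 1 = n)
    (f : VecIdx n → ℂ) (p : Fin n) :
    (vecRep (row d) *ᵥ f) (.inr (.inr p)) =
      (d p : ℂ)⁻¹ * (∑ b ∈ Finset.Ico p i, d (b + 1) * f (.inr (.inr b))
        + (f (.inl i) + 2 * d n * f (.inr (.inl ())) + d n ^ 2 * f (.inr (.inr i)))) := by
  rw [row_eq_mul_yBold hi, vecRep_mul_mulVec, vecRep_rowInit_mulVec_inr hd i.isLt,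
    if_pos (by omega), vecRep_yBold]
  congr 2
  · refine Finset.sum_congr rfl fun b hb => ?_
    simp [vecRankOne_mulVec_of_last hi, (Finset.mem_Ico.1 hb).2.ne]
  · simp [vecRankOne_mulVec_of_last hi]

theorem vecRep_row_mulVec_inr_of_lt {d : ℕ → ℂˣ} (hd : d 0 = 1) {p : Fin n} (hp : p.val + 1 < n)
    (f : VecIdx n → ℂ) :
    d p * (vecRep (row d) *ᵥ f) (.inr (.inr p)) =
      d (p + 1) * (f (.inr (.inr p)) + (vecRep (row d) *ᵥ f) (.inr (.inr ⟨p.val + 1, hp⟩))) := by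
  obtain ⟨i, hi⟩ : ∃ i : Fin n, i.val + 1 = n := ⟨⟨n - 1, by omega⟩, by simp; omega⟩
  have hIco : Finset.Ioo p i = Finset.Ico ⟨p.val + 1, hp⟩ i := by
    ext b
    simp only [Finset.mem_Ioo, Finset.mem_Ico, Fin.lt_def, Fin.le_def, Nat.succ_le_iff]
  rw [vecRep_row_mulVec_inr hd hi, vecRep_row_mulVec_inr hd hi, 
    mul_inv_cancel_left₀ (Units.ne_zero _), mul_add (d (p.val + 1) : ℂ),
    mul_inv_cancel_left₀ (Units.ne_zero _), ← hIco,
    ← Finset.add_sum_Ioo_eq_sum_Ico (Fin.lt_def.2 (by omega)), add_assoc]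

theorem vecRep_row_mulVec_inl_of_eq_zero {d : ℕ → ℂˣ} (hd : d 0 = 1) {f : VecIdx n → ℂ} {p : Fin n}
    (hf : f (.inl p) = 0) : (vecRep (row d) *ᵥ f) (.inl p) = predCoord f p := by
  rcases succ_lt_or_succ_eq p with hp | hp
  · rw [vecRep_row_mulVec_inl_of_lt hd hp, hf, mul_zero, add_zero]
  · rw [vecRep_row_mulVec_inl_of_last hd hp, hf, mul_zero, add_zero]

theorem vecRep_mul_apply (g h : G n) (a b : VecIdx n) :
    vecRep (g * h) a b = (vecRep g *ᵥ (vecRep h).col b) a := by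
  rw [map_mul]
  rfl

theorem vecRep_thetaRows_inl_inl_of_lt {c : ℕ → ℕ → ℂˣ} (hc : ∀ m, c m 0 = 1) (m : ℕ) {k : ℕ}
    {p q : Fin n} (hpq : q.val + k < p) : vecRep (thetaRows c m k) (.inl p) (.inl q) = 0 := by
  induction k generalizing m p with
  | zero =>
    have hne : p ≠ q := by rintro rfl; exact lt_irrefl _ hpq
    rw [thetaRows_zero, map_one, Matrix.one_apply_ne (Sum.inl_injective.ne hne)]
  | succ k ih =>
    have hp : (vecRep (thetaRows c (m + 1) k)).col (.inl q) (.inl p) = 0 := ih (m + 1) (by omega)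
    rw [thetaRows_succ, vecRep_mul_apply, vecRep_row_mulVec_inl_of_eq_zero (hc _) hp, predCoord,
      if_neg (by omega)]
    exact ih (m + 1) (by simp; omega)

theorem vecRep_thetaRows_inl_inl_of_eq {c : ℕ → ℕ → ℂˣ} (hc : ∀ m, c m 0 = 1) (m : ℕ) {k : ℕ}
    {p q : Fin n} (hpq : q.val + k = p) : vecRep (thetaRows c m k) (.inl p) (.inl q) = 1 := by
  induction k generalizing m p with
  | zero =>
    obtain rfl : q = p := Fin.ext hpq
    rw [thetaRows_zero, map_one, Matrix.one_apply_eq]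
  | succ k ih =>
    have hp : (vecRep (thetaRows c (m + 1) k)).col (.inl q) (.inl p) = 0 :=
      vecRep_thetaRows_inl_inl_of_lt hc (m + 1) (by omega)
    rw [thetaRows_succ, vecRep_mul_apply, vecRep_row_mulVec_inl_of_eq_zero (hc _) hp, predCoord,
      if_neg (by omega)]
    exact ih (m + 1) (by simp; omega)

theorem vecRep_thetaRows_inl_inl_of_succ_eq {c : ℕ → ℕ → ℂˣ} (hc : ∀ m, c m 0 = 1) (m : ℕ) {k : ℕ}
    {p q : Fin n} (hpq : p.val + 1 = q + k) (hk : q.val + k < n) :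
    vecRep (thetaRows c m k) (.inl p) (.inl q) =
      ∑ j ∈ Finset.Icc (m + 1) (m + k), (c j (q + m + k - j) : ℂ) / c j (q + m + k - j + 1) := by
  induction k generalizing m p with
  | zero =>
    have hne : p ≠ q := by rintro rfl; omega
    rw [thetaRows_zero, map_one, Matrix.one_apply_ne (Sum.inl_injective.ne hne),
      Finset.Icc_eq_empty (by omega), Finset.sum_empty]
  | succ k ih =>
    have hind : q.val + m + (k + 1) - (m + 1) = p := by omega
    rw [thetaRows_succ, vecRep_mul_apply, vecRep_row_mulVec_inl_of_lt (hc _) (by omega),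
      Matrix.col_apply, vecRep_thetaRows_inl_inl_of_eq hc (m + 1) (by omega), mul_one,
      ← Finset.add_sum_Ioc_eq_sum_Icc (show m + 1 ≤ m + (k + 1) by omega), hind, add_comm,
      ← Finset.Icc_add_one_left_eq_Ioc, predCoord]
    congr 1
    split_ifs with hp
    · rw [Finset.Icc_eq_empty (by omega), Finset.sum_empty]
    · rw [Matrix.col_apply, ih (m + 1) (by simp; omega) (by omega),
        show m + 1 + k = m + (k + 1) by omega, show q.val + (m + 1) + k = q + m + (k + 1) by omega]

theorem vecRep_thetaRows_inr_inl {c : ℕ → ℕ → ℂˣ} (hc : ∀ m, c m 0 = 1) (m : ℕ) {k : ℕ}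
    {q : Fin n} (hk : q.val + k < n) (a : Unit ⊕ Fin n) :
    vecRep (thetaRows c m k) (.inr a) (.inl q) = 0 := by
  induction k generalizing m a with
  | zero => rw [thetaRows_zero, map_one, Matrix.one_apply_ne (by simp)]
  | succ k ih =>
    obtain ⟨i, hi⟩ : ∃ i : Fin n, i.val + 1 = n := ⟨⟨n - 1, by omega⟩, by simp; omega⟩
    have hlast : vecRep (thetaRows c (m + 1) k) (.inl i) (.inl q) = 0 :=
      vecRep_thetaRows_inl_inl_of_lt hc (m + 1) (by omega)
    rw [thetaRows_succ, vecRep_mul_apply]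
    rcases a with _ | p
    · simp [vecRep_row_mulVec_mid _ hi, ih (m + 1) (by omega), hlast]
    · simp [vecRep_row_mulVec_inr (hc _) hi, ih (m + 1) (by omega), hlast]

end Theta

section Elimination

variable {n : ℕ}

theorem det_vecRep_row {d : ℕ → ℂˣ} (hd : d 0 = 1) {s : ℕ} (hs : s < n) {i : Fin n}
    (hi : i.val + 1 = n) (g : Fin (s + 1) → VecIdx n → ℂ) (hg : g 0 (.inl i) = 1)
    (hg' : ∀ a, g 0 (.inr a) = 0) :
    det (of fun p q => (-1) ^ p.val *
        (vecRep (row d) *ᵥ g q) (.inr (.inr (Fin.castLE hs p)))) =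
      det (of fun p q : Fin s => (-1) ^ p.val * g q.succ (.inr (.inr (Fin.castLE hs.le p)))) := by
  rw [det_eq_of_forall_row_eq_smul_sub_succ
    (of fun p q => (-1) ^ p.val * g q (.inr (.inr (Fin.castLE hs.le p))))
    (fun p => (d (p + 1) : ℂ) / d p) (fun p q => ?_) fun p => ?_]
  · have hprod : ∏ p : Fin s, (d (p + 1) : ℂ) / d p = d s := by
      rw [Fin.prod_univ_eq_prod_range fun p => (d (p + 1) : ℂ) / d p]
      have := congrArg Units.val (Finset.prod_range_div d s)
      simpa [hd, Units.coe_prod] using this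
    rw [hprod, of_apply, vecRep_row_mulVec_inr hd hi]
    simp only [Fin.val_last, Fin.val_castLE, hg, hg', mul_zero, Finset.sum_const_zero, add_zero,
      zero_add, mul_one, ← mul_assoc, ← mul_pow, mul_neg, neg_neg, one_pow, one_mul]
    rw [inv_mul_cancel₀ (Units.ne_zero _), one_mul]
    rfl
  · have hrow := vecRep_row_mulVec_inr_of_lt hd (p := Fin.castLE hs.le p) (by simp; omega) (g q)
    have hS : (vecRep (row d) *ᵥ g q) (.inr (.inr (Fin.castLE hs p.castSucc))) =
        (d (p + 1) : ℂ) / d p * (g q (.inr (.inr (Fin.castLE hs.le p))) +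
          (vecRep (row d) *ᵥ g q) (.inr (.inr (Fin.castLE hs p.succ)))) := by
      rw [div_mul_eq_mul_div, eq_div_iff (Units.ne_zero _), mul_comm]
      exact hrow
    simp only [of_apply, hS, Fin.val_castSucc, Fin.val_succ, pow_succ]
    ring
  · rw [of_apply, hg', mul_zero]

theorem det_vecRep_thetaRows {c : ℕ → ℕ → ℂˣ} (hc : ∀ m, c m 0 = 1) {s : ℕ} (hs : s < n) {m k : ℕ}
    (hm : m + s + k = n) (σ : Fin (s + 1) → Fin n) (hσ : ∀ q : Fin s, (σ q.castSucc).val = m + q) :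
    det (of fun p q => (-1) ^ p.val *
        vecRep (thetaRows c m (s + k)) (.inr (.inr (Fin.castLE hs p))) (.inl (σ q))) =
      vecRep (thetaRows c (m + s) k) (.inr (.inr ⟨0, (Nat.zero_le s).trans_lt hs⟩))
        (.inl (σ (Fin.last s))) := by
  induction s generalizing m with
  | zero =>
    simp only [Matrix.det_unique, of_apply, Fin.default_eq_zero, Fin.val_eq_zero, pow_zero, one_mul,
      zero_add, add_zero]
    rfl
  | succ s ih =>
    obtain ⟨i, hi⟩ : ∃ i : Fin n, i.val + 1 = n := ⟨⟨n - 1, by omega⟩, by simp; omega⟩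
    have hσ0 : (σ 0).val = m := hσ 0
    simp only [add_right_comm s 1 k, thetaRows_succ, vecRep_mul_apply]
    rw [det_vecRep_row (hc _) hs hi
      (fun q => (vecRep (thetaRows c (m + 1) (s + k))).col (.inl (σ q)))
      (vecRep_thetaRows_inl_inl_of_eq hc _ (by omega))
      fun a => vecRep_thetaRows_inr_inl hc _ (by omega) a]
    have hih := ih (by omega) (m := m + 1) (by omega) (σ ∘ Fin.succ) fun q => by
      rw [Function.comp_apply, Fin.succ_castSucc, hσ, Fin.val_succ]
      omega
    simp only [add_right_comm m 1 s] at hih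
    exact hih

theorem vecRep_sBar_col {i : Fin n} (h : i.val + 1 < n) {b : VecIdx n} (hb : vecWt b i ≠ -1) :
    (vecRep (sBar i)).col b = Pi.single (reflVec i b) 1 := by
  have hrep : vecRep (sBar i) = vecRankOne i !![0, -1; 1, 0] := congrArg Prod.fst (rep_sBar i)
  ext a
  have hab : a = reflVec i b ↔ reflVec i a = b := by
    rw [← (reflVec_involutive i).eq_iff, eq_comm]
  rw [← Matrix.mulVec_single_one, hrep, vecRankOne_mulVec_of_lt h]
  simp only [Pi.single_apply, hab]
  by_cases h₁ : vecWt a i = 1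
  · have hne : reflVec i a ≠ b := by
      rintro rfl
      exact hb (by rw [vecWt_reflVec_self, h₁])
    simp [h₁, hne]
  by_cases h₂ : vecWt a i = -1
  · simp [h₂]
  have h₀ : vecWt a i = 0 := by
    have := abs_le.1 (abs_vecWt_le_of_lt h a)
    omega
  rw [if_neg h₁, if_neg h₂, reflVec_eq_self h₀]

theorem IsLongest.leadingMinor_thetaRows {w : Weyl n} (hw : IsLongest w) {c : ℕ → ℕ → ℂˣ}
    (hc : ∀ m, c m 0 = 1) {i : Fin n} (h : i.val + 1 < n) :
    leadingMinor i ((weylLift w)⁻¹ * thetaRows c 0 n * sBar i) =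
      vecRep (thetaRows c i (n - i)) (.inr (.inr ⟨0, by omega⟩)) (.inl ⟨i.val + 1, h⟩) := by
  have hdet := det_vecRep_thetaRows hc i.isLt (m := 0) (k := n - i) (by omega)
    (fun q => Equiv.swap i ⟨i.val + 1, h⟩ (Fin.castLE i.isLt q)) fun q => by
      rw [Equiv.swap_apply_of_ne_of_ne] <;> simp [Fin.ext_iff] <;> omega
  have hσ : Equiv.swap i ⟨i.val + 1, h⟩ (Fin.castLE i.isLt (Fin.last i)) = ⟨i.val + 1, h⟩ :=
    Equiv.swap_apply_left _ _
  rw [hσ, zero_add, Nat.add_sub_cancel' i.isLt.le] at hdet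
  rw [← hdet, leadingMinor]
  congr 1
  ext p q
  have hq : vecWt (.inl (Fin.castLE i.isLt q)) i ≠ -1 := by
    rw [vecWt, eps]
    have hqi : (Fin.castLE i.isLt q).val ≠ i + 1 := q.isLt.ne
    split_ifs <;> omega
  rw [Matrix.submatrix_apply, of_apply, mul_assoc, vecRep_mul_apply]
  simp only [Function.comp_apply]
  rw [hw.vecRep_weylLift_inv_mulVec_inl, Matrix.col_apply, vecRep_mul_apply, vecRep_sBar_col h hq,
    Matrix.mulVec_single_one, reflVec_of_lt h]
  rfl

theorem sum_Ico_zero_fin_eq (hn : 2 ≤ n) {i : Fin n} (hi : i.val + 1 = n) (F : ℕ → ℂ) :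
    ∑ b ∈ Finset.Ico ⟨0, by omega⟩ i, F (b.val + 1) = F 1 + ∑ j ∈ Finset.Icc 2 (n - 1), F j := by
  have hmap := Finset.sum_map (Finset.Ico ⟨0, by omega⟩ i) Fin.valEmbedding fun b => F (b + 1)
  simp only [Fin.map_valEmbedding_Ico, Fin.valEmbedding_apply] at hmap
  rw [← hmap, Finset.sum_Ico_add' F, Finset.sum_eq_sum_Ico_succ_bot (by omega), hi]
  congr 2

theorem vecRep_row_mulVec_row_mulVec_corner {e d : ℕ → ℂˣ} (he : e 0 = 1) (hd : d 0 = 1)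
    {i j : Fin n} (hi : i.val + 1 = n) (hj : j.val + 2 = n) {f : VecIdx n → ℂ}
    (hf : f (.inl i) = 1) (hf' : ∀ a, f (.inr a) = 0) :
    (vecRep (row e) *ᵥ (vecRep (row d) *ᵥ f)) (.inr (.inr ⟨0, by omega⟩)) =
      (e 1 : ℂ) + ∑ j ∈ Finset.Icc 2 (n - 1), (e j : ℂ) / d (j - 1) + (e n : ℂ) ^ 2 / d (n - 1)
        + 2 * ((e n : ℂ) / d n) + (d (n - 1) : ℂ) / d n ^ 2 + f (.inl j) := by
  have hinr (p : Fin n) : (vecRep (row d) *ᵥ f) (.inr (.inr p)) = (d p : ℂ)⁻¹ := by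
    rw [vecRep_row_mulVec_inr hd hi]
    simp [hf, hf']
  have hpred : predCoord f i = f (.inl j) := by
    rw [predCoord, if_neg (by omega)]
    congr 2
    exact Fin.ext (by simp; omega)
  have hin : i.val = n - 1 := by omega
  have hsum := sum_Ico_zero_fin_eq (by omega) hi fun j => (e j : ℂ) * (d (j - 1) : ℂ)⁻¹
  simp only [Nat.add_sub_cancel, Nat.sub_self, hd, Units.val_one, inv_one, mul_one] at hsum
  rw [vecRep_row_mulVec_inr he hi, vecRep_row_mulVec_mid _ hi, vecRep_row_mulVec_inl_of_last hd hi]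
  simp only [hinr, hsum, he, hpred, hf, hf', hin, Units.val_one, div_eq_mul_inv]
  ring

theorem vecRep_thetaRows_corner {c : ℕ → ℕ → ℂˣ} (hc : ∀ m, c m 0 = 1) {i : Fin n}
    (h : i.val + 1 < n) {k : ℕ} (hk : k = i.val + 1) :
    vecRep (thetaRows c i (n - i)) (.inr (.inr ⟨0, by omega⟩)) (.inl ⟨i.val + 1, h⟩) =
      (c k 1 : ℂ) + ∑ j ∈ Finset.Icc 2 (n - 1), (c k j : ℂ) / c (k + 1) (j - 1)
        + (c k n : ℂ) ^ 2 / c (k + 1) (n - 1) + 2 * ((c k n : ℂ) / c (k + 1) n)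
        + (c (k + 1) (n - 1) : ℂ) / c (k + 1) n ^ 2
        + ∑ m ∈ Finset.Icc (k + 2) n, (c m (n + k - m) : ℂ) / c m (n + k - m + 1) := by
  obtain ⟨l, hl⟩ : ∃ l, i.val + 2 + l = n := ⟨n - (i + 2), by omega⟩
  set q : Fin n := ⟨i.val + 1, h⟩
  have hq : q.val = i + 1 := rfl
  have hlast : (⟨n - 1, by omega⟩ : Fin n).val + 1 = n := Nat.sub_add_cancel (by omega)
  have hprev : (⟨n - 2, by omega⟩ : Fin n).val + 2 = n := Nat.sub_add_cancel (by omega)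
  have hcol : (vecRep (thetaRows c (i + 1) (l + 1))).col (.inl q) =
      vecRep (row (c (i + 2))) *ᵥ (vecRep (thetaRows c (i + 2) l)).col (.inl q) := by
    ext a
    rw [Matrix.col_apply, thetaRows_succ, vecRep_mul_apply]
  have hfirst := vecRep_row_mulVec_row_mulVec_corner (hc (i + 1)) (hc (i + 2)) hlast hprev
    (f := (vecRep (thetaRows c (i + 2) l)).col (.inl q))
    (vecRep_thetaRows_inl_inl_of_eq hc _ (by simp only [hq]; omega))
    fun a => vecRep_thetaRows_inr_inl hc _ (by omega) a
  have hpath := vecRep_thetaRows_inl_inl_of_succ_eq hc (i + 2) (k := l) (p := ⟨n - 2, by omega⟩)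
    (q := q) (by simp only [hq]; omega) (by omega)
  rw [show n - i.val = l + 1 + 1 by omega, thetaRows_succ, vecRep_mul_apply, hcol, hfirst,
    Matrix.col_apply, hpath, hl, hk, hq, show i.val + 1 + (i + 2) + l = n + (i + 1) by omega]

theorem IsLongest.leadingMinor_thetaRows_eq {w : Weyl n} (hw : IsLongest w) (c : ℕ → ℕ → ℂˣ)
    {i : Fin n} (h : i.val + 1 < n) {k : ℕ} (hk : k = i.val + 1) :
    leadingMinor i ((weylLift w)⁻¹ * thetaRows c 0 n * sBar i) =
      (c k 1 : ℂ) + ∑ j ∈ Finset.Icc 2 (n - 1), (c k j : ℂ) / c (k + 1) (j - 1)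
        + (c k n : ℂ) ^ 2 / c (k + 1) (n - 1) + 2 * ((c k n : ℂ) / c (k + 1) n)
        + (c (k + 1) (n - 1) : ℂ) / c (k + 1) n ^ 2
        + ∑ m ∈ Finset.Icc (k + 2) n, (c m (n + k - m) : ℂ) / c m (n + k - m + 1) := by
  wlog hc : ∀ m, c m 0 = 1 generalizing c
  · set c' : ℕ → ℕ → ℂˣ := fun m => Function.update (c m) 0 1
    have hrows : (thetaRows c' 0 n : G n) = thetaRows c 0 n := by
      simp only [thetaRows, row, rowInit, c', Function.update_of_ne (Nat.succ_ne_zero _)]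
    have hc' (m : ℕ) {j : ℕ} (hj : j ≠ 0) : c' m j = c m j := Function.update_of_ne hj _ _
    have hsum : ∑ j ∈ Finset.Icc 2 (n - 1), (c' k j : ℂ) / c' (k + 1) (j - 1) =
        ∑ j ∈ Finset.Icc 2 (n - 1), (c k j : ℂ) / c (k + 1) (j - 1) :=
      Finset.sum_congr rfl fun j hj => by
        have := Finset.mem_Icc.1 hj
        rw [hc' _ (by omega), hc' _ (by omega)]
    have hsum' : ∑ m ∈ Finset.Icc (k + 2) n, (c' m (n + k - m) : ℂ) / c' m (n + k - m + 1) =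
        ∑ m ∈ Finset.Icc (k + 2) n, (c m (n + k - m) : ℂ) / c m (n + k - m + 1) :=
      Finset.sum_congr rfl fun m hm => by
        have := Finset.mem_Icc.1 hm
        rw [hc' _ (by omega), hc' _ (by omega)]
    rw [← hrows, this c' fun m => Function.update_self .., hsum, hsum', hc' _ one_ne_zero,
      hc' _ (by omega), hc' _ (by omega), hc' _ (by omega)]
  rw [hw.leadingMinor_thetaRows hc h, vecRep_thetaRows_corner hc h hk]

end Elimination

/-! ### The spin representation of `Θ⁻` -/

section Spin

variable {n : ℕ}

/-- The number of minus signs of a basis vector of the spin representation: the degree of the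
filtration that `Θ⁻` raises by at most one in every row. -/
def minusCount (s : SpinIdx n) : ℕ := Finset.card {p | s p = false}

theorem minusCount_spinRefl_of_lt {i : Fin n} (h : i.val + 1 < n) (s : SpinIdx n) :
    minusCount (spinRefl i s) = minusCount s := by
  rw [spinRefl_of_lt h]
  exact Finset.card_equiv (Equiv.swap i ⟨i.val + 1, h⟩) (by simp)

theorem minusCount_le_minusCount_spinRefl_add_one (i : Fin n) (s : SpinIdx n) :
    minusCount s ≤ minusCount (spinRefl i s) + 1 := by
  rcases succ_lt_or_succ_eq i with h | h
  · rw [minusCount_spinRefl_of_lt h]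
    exact Nat.le_succ _
  · refine (Finset.card_le_card fun p hp => ?_).trans (Finset.card_insert_le i _)
    rw [Finset.mem_insert, or_iff_not_imp_left]
    intro hpi
    simpa [spinRefl_of_last h, Function.update_of_ne hpi] using hp

/-- The basis vector of the spin representation whose minus signs are the first `t` ones. -/
def minusFirst (t : ℕ) : SpinIdx n := fun p => decide (t ≤ p.val)

/-- The basis vector of the spin representation whose minus signs are the first `t` ones and the
one at the place `j`. -/
def minusFirstAnd (t : ℕ) (j : Fin n) : SpinIdx n := Function.update (minusFirst t) j false

theorem minusFirst_zero : (minusFirst 0 : SpinIdx n) = ⊤ := by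
  ext p
  simp [minusFirst]

theorem minusFirst_self : (minusFirst n : SpinIdx n) = ⊥ := by
  ext p
  simp [minusFirst]

theorem minusFirstAnd_self (t : Fin n) : minusFirstAnd t t = minusFirst (t.val + 1) := by
  ext p
  rcases eq_or_ne p t with rfl | hp
  · simp [minusFirstAnd, minusFirst]
  · have := Fin.val_ne_of_ne hp
    rw [minusFirstAnd, Function.update_of_ne hp, minusFirst, minusFirst, decide_eq_decide]
    omega

theorem minusCount_minusFirstAnd {t : ℕ} {j : Fin n} (h : t ≤ j) :
    minusCount (minusFirstAnd t j) = t + 1 := by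
  have hset : ({p | minusFirstAnd t j p = false} : Finset (Fin n)) =
      insert j (Finset.univ.filter fun p => p.val < t) := by
    ext p
    rw [Finset.mem_filter_univ, Finset.mem_insert, Finset.mem_filter_univ]
    rcases eq_or_ne p j with rfl | hp
    · simp [minusFirstAnd]
    · simp [minusFirstAnd, minusFirst, hp]
  rw [minusCount, hset, Finset.card_insert_of_notMem (by simpa using h), Fin.card_filter_val_lt,
    min_eq_right (h.trans j.isLt.le)]

theorem spinWt_minusFirst_succ_of_lt {t : ℕ} {i : Fin n} (h : i.val < t) (ht : t < n) :
    spinWt (minusFirst (t + 1)) i = 0 := by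
  have hi : i.val + 1 < n := by omega
  simp [spinWt, minusFirst, hi, show ¬t + 1 ≤ i by omega, show ¬t ≤ i by omega]

theorem spinWt_minusFirstAnd_self {t : ℕ} {j : Fin n} (h : t ≤ j) :
    spinWt (minusFirstAnd t j) j = -1 := by
  rcases succ_lt_or_succ_eq j with hj | hj
  · simp [spinWt, minusFirstAnd, minusFirst, hj, Fin.ext_iff, show t ≤ j + 1 by omega]
  · simp [spinWt, minusFirstAnd, hj]

theorem spinWt_minusFirstAnd_of_lt {t : ℕ} {i j : Fin n} (ht : t ≤ i) (h : i < j) :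
    spinWt (minusFirstAnd t i) j ≠ -1 := by
  have hij : i.val < j := h
  simp only [spinWt, minusFirstAnd, Function.update_of_ne h.ne', minusFirst,
    decide_eq_true (ht.trans hij.le)]
  split_ifs
  · simp [Fin.ext_iff, minusFirst, show j.val + 1 ≠ i by omega,
      show t ≤ j + 1 by omega]
  · simp

theorem spinRefl_minusFirstAnd_of_lt {t : ℕ} {j : Fin n} (ht : t ≤ j) (h : j.val + 1 < n) :
    spinRefl j (minusFirstAnd t j) = minusFirstAnd t ⟨j.val + 1, h⟩ := by
  rw [spinRefl_of_lt h, minusFirstAnd, minusFirstAnd]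
  ext p
  simp only [Function.comp_apply, Function.update_apply, Equiv.swap_apply_eq_iff,
    Equiv.swap_apply_left]
  split_ifs with hp
  · rfl
  rcases eq_or_ne p j with rfl | hpj
  · simp [minusFirst, ht, ht.trans (Nat.le_succ _)]
  · rw [Equiv.swap_apply_of_ne_of_ne hpj hp]

theorem spinRefl_minusFirstAnd_of_last {t : ℕ} {j : Fin n} (ht : t ≤ j) (h : j.val + 1 = n) :
    spinRefl j (minusFirstAnd t j) = minusFirst t := by
  rw [spinRefl_of_last h, minusFirstAnd, Function.update_idem, Function.update_self]
  exact Function.update_eq_self_iff.2 (decide_eq_true ht).symm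

theorem spinRep_yBold_mulVec (i : Fin n) (c : ℂˣ) (f : SpinIdx n → ℂ) (s : SpinIdx n) :
    (spinRep (yBold i c) *ᵥ f) s =
      if spinWt s i = 1 then (c : ℂ)⁻¹ * f s
      else if spinWt s i = -1 then f (spinRefl i s) + c * f s
      else f s := by
  have hrep : spinRep (yBold i c) = spinRankOne i !![(c : ℂ)⁻¹, 0; 1, c] :=
    congrArg Prod.snd (rep_yBold i c)
  simp [hrep, spinRankOne_mulVec]

theorem spinRep_mul_mulVec (g h : G n) (f : SpinIdx n → ℂ) :
    spinRep (g * h) *ᵥ f = spinRep g *ᵥ (spinRep h *ᵥ f) := by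
  rw [map_mul, Matrix.mulVec_mulVec]

theorem spinRep_rowInit_mulVec_minusFirst_succ (d : ℕ → ℂˣ) {t j : ℕ} (hj : j ≤ t) (ht : t < n)
    (f : SpinIdx n → ℂ) :
    (spinRep (rowInit d (hj.trans ht.le)) *ᵥ f) (minusFirst (t + 1)) = f (minusFirst (t + 1)) := by
  induction j generalizing f with
  | zero => rw [rowInit_zero, map_one, Matrix.one_mulVec]
  | succ j ih =>
    rw [rowInit_succ d (Nat.lt_of_lt_of_le hj ht.le), spinRep_mul_mulVec, ih (by omega),
      spinRep_yBold_mulVec, spinWt_minusFirst_succ_of_lt (by exact hj) ht]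
    simp

theorem spinRep_yBold_mulVec_minusFirstAnd_eq_zero {t : ℕ} {i j : Fin n} (ht : t ≤ i) (h : i < j)
    (c : ℂˣ) {f : SpinIdx n → ℂ} (hf : f (minusFirstAnd t i) = 0) :
    (spinRep (yBold j c) *ᵥ f) (minusFirstAnd t i) = 0 := by
  simp [spinRep_yBold_mulVec, spinWt_minusFirstAnd_of_lt ht h, hf]

theorem spinRep_rowInit_mulVec_minusFirst (d : ℕ → ℂˣ) {t j : Fin n} (htj : t ≤ j)
    {f : SpinIdx n → ℂ} (hf : ∀ i, t ≤ i → i < j → f (minusFirstAnd t i) = 0) :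
    (spinRep (rowInit d j.isLt.le) *ᵥ f) (minusFirst (t.val + 1)) = f (minusFirstAnd t j) := by
  obtain ⟨j, hj⟩ := j
  induction j, (show t.val ≤ j from htj) using Nat.le_induction generalizing f with
  | base => rw [spinRep_rowInit_mulVec_minusFirst_succ d le_rfl hj, minusFirstAnd_self]
  | succ j htj' ih =>
    have hlast : f (minusFirstAnd t ⟨j, by omega⟩) = 0 := hf _ htj' (Nat.lt_succ_self j)
    rw [rowInit_succ d (by omega), spinRep_mul_mulVec, ih (by omega) htj' fun i hti hij =>
      spinRep_yBold_mulVec_minusFirstAnd_eq_zero hti hij _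
        (hf i hti (hij.trans (Nat.lt_succ_self j))),
      spinRep_yBold_mulVec, spinWt_minusFirstAnd_self htj', spinRefl_minusFirstAnd_of_lt htj' hj,
      hlast]
    simp

theorem spinRep_row_mulVec_minusFirst (d : ℕ → ℂˣ) {t i : Fin n} (hi : i.val + 1 = n)
    {f : SpinIdx n → ℂ} (hf : ∀ j, t ≤ j → f (minusFirstAnd t j) = 0) :
    (spinRep (row d) *ᵥ f) (minusFirst (t.val + 1)) = f (minusFirst t) := by
  have hti : t ≤ i := Fin.le_def.2 (by omega)
  rw [row_eq_mul_yBold hi, spinRep_mul_mulVec, spinRep_rowInit_mulVec_minusFirst d hti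
    fun j htj hji => spinRep_yBold_mulVec_minusFirstAnd_eq_zero htj hji _ (hf j htj),
    spinRep_yBold_mulVec, spinWt_minusFirstAnd_self hti, spinRefl_minusFirstAnd_of_last hti hi,
    hf i hti]
  simp

theorem spinRep_yBold_mulVec_eq_zero (i : Fin n) (c : ℂˣ) {f : SpinIdx n → ℂ} {s : SpinIdx n}
    (hs : f s = 0) (hs' : f (spinRefl i s) = 0) : (spinRep (yBold i c) *ᵥ f) s = 0 := by
  simp [spinRep_yBold_mulVec, hs, hs']

theorem spinRep_rowInit_mulVec_eq_zero (d : ℕ → ℂˣ) {j a : ℕ} (hj : j < n) {f : SpinIdx n → ℂ}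
    (hf : ∀ s, a < minusCount s → f s = 0) {s : SpinIdx n} (hs : a < minusCount s) :
    (spinRep (rowInit d hj.le) *ᵥ f) s = 0 := by
  induction j generalizing f with
  | zero => rw [rowInit_zero, map_one, Matrix.one_mulVec, hf s hs]
  | succ j ih =>
    rw [rowInit_succ d (by omega), spinRep_mul_mulVec]
    refine ih (by omega) fun s' hs' => spinRep_yBold_mulVec_eq_zero _ _ (hf s' hs') (hf _ ?_)
    rwa [minusCount_spinRefl_of_lt hj]

theorem spinRep_row_mulVec_eq_zero (d : ℕ → ℂˣ) {i : Fin n} (hi : i.val + 1 = n) {a : ℕ}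
    {f : SpinIdx n → ℂ} (hf : ∀ s, a < minusCount s → f s = 0) {s : SpinIdx n}
    (hs : a + 1 < minusCount s) : (spinRep (row d) *ᵥ f) s = 0 := by
  rw [row_eq_mul_yBold hi, spinRep_mul_mulVec]
  refine spinRep_rowInit_mulVec_eq_zero d i.isLt (fun s' hs' => ?_) hs
  have := minusCount_le_minusCount_spinRefl_add_one i s'
  exact spinRep_yBold_mulVec_eq_zero i _ (hf s' (by omega)) (hf _ (by omega))

theorem spinRep_yBold_mul_sBar_mulVec_single_top {i : Fin n} (hi : i.val + 1 = n) (c : ℂˣ) :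
    spinRep (yBold i c * sBar i) *ᵥ Pi.single ⊤ 1 = Pi.single (minusFirstAnd 0 i) (c : ℂ) := by
  have hrep : spinRep (yBold i c * sBar i) = spinRankOne i !![0, -(c : ℂ)⁻¹; c, -1] := by
    have hy : spinRep (yBold i c) = _ := congrArg Prod.snd (rep_yBold i c)
    have hs : spinRep (sBar i) = _ := congrArg Prod.snd (rep_sBar i)
    rw [map_mul, hy, hs]
    change spinRankOne i _ * spinRankOne i _ = _
    rw [← map_mul]
    simp
  have hrefl (s : SpinIdx n) : spinRefl i s = ⊤ ↔ s = minusFirstAnd 0 i := by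
    rw [(spinRefl_involutive i).eq_iff, ← minusFirst_zero,
      ← spinRefl_minusFirstAnd_of_last (Nat.zero_le _) hi, spinRefl_involutive, eq_comm]
  have hwt : spinWt (minusFirstAnd 0 i) i = -1 := spinWt_minusFirstAnd_self (Nat.zero_le _)
  have htop : spinWt (⊤ : SpinIdx n) i = 1 := by
    rw [← (hrefl _).2 rfl, spinWt_spinRefl_self, hwt, neg_neg]
  ext s
  simp only [hrep, spinRankOne_mulVec, Pi.single_apply, hrefl]
  rcases eq_or_ne s (minusFirstAnd 0 i) with rfl | hs
  · have hne : minusFirstAnd 0 i ≠ ⊤ := fun h => by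
      rw [h, htop] at hwt
      exact absurd hwt (by decide)
    simp [hwt, hne]
  rcases eq_or_ne s ⊤ with rfl | hs'
  · simp [htop, hs]
  · simp [hs, hs']

theorem spinRep_thetaRows_mul_sBar {i : Fin n} (hi : i.val + 1 = n) (c : ℕ → ℕ → ℂˣ) {m k : ℕ}
    (hmk : m + k + 1 = n) :
    (spinRep (thetaRows c m (k + 1) * sBar i) *ᵥ Pi.single ⊤ 1) (minusFirst (k + 1)) = c n n ∧
      ∀ s, k + 1 < minusCount s →
        (spinRep (thetaRows c m (k + 1) * sBar i) *ᵥ Pi.single ⊤ 1) s = 0 := by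
  induction k generalizing m with
  | zero =>
    have hfirst : spinRep (thetaRows c m 1 * sBar i) *ᵥ Pi.single ⊤ 1 =
        spinRep (rowInit (c n) i.isLt.le) *ᵥ Pi.single (minusFirstAnd 0 i) (c n n : ℂ) := by
      rw [thetaRows_succ, thetaRows_zero, mul_one, row_eq_mul_yBold hi, mul_assoc,
        spinRep_mul_mulVec, show m + 1 = n from hmk, spinRep_yBold_mul_sBar_mulVec_single_top hi]
    have hsingle {s : SpinIdx n} (hs : s ≠ minusFirstAnd 0 i) :
        (Pi.single (minusFirstAnd 0 i) (c n n : ℂ) : SpinIdx n → ℂ) s = 0 :=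
      Pi.single_eq_of_ne hs _
    rw [hfirst]
    refine ⟨?_, fun s hs => spinRep_rowInit_mulVec_eq_zero _ i.isLt (fun s' hs' => ?_) hs⟩
    · rw [spinRep_rowInit_mulVec_minusFirst (t := ⟨0, by omega⟩) _ (Nat.zero_le _),
        Pi.single_eq_same]
      intro j _ hji
      refine hsingle fun h => spinWt_minusFirstAnd_of_lt (Nat.zero_le _) hji ?_
      rw [h, spinWt_minusFirstAnd_self (Nat.zero_le _)]
    · refine hsingle ?_
      rintro rfl
      exact hs'.ne' (minusCount_minusFirstAnd (Nat.zero_le _))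
  | succ k ih =>
    obtain ⟨hval, hsupp⟩ := ih (m := m + 1) (by omega)
    rw [thetaRows_succ, mul_assoc, spinRep_mul_mulVec]
    refine ⟨?_, fun s => spinRep_row_mulVec_eq_zero _ hi hsupp⟩
    rw [← hval]
    refine spinRep_row_mulVec_minusFirst _ (t := ⟨k + 1, by omega⟩) hi fun j hj => hsupp _ ?_
    rw [minusCount_minusFirstAnd hj]
    exact Nat.lt_succ_self _

theorem IsLongest.spinCorner_thetaRows {w : Weyl n} (hw : IsLongest w) {i : Fin n}
    (hi : i.val + 1 = n) (c : ℕ → ℕ → ℂˣ) :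
    spinCorner ((weylLift w)⁻¹ * thetaRows c 0 n * sBar i) = c n n := by
  have hcol : spinCorner ((weylLift w)⁻¹ * thetaRows c 0 n * sBar i) =
      (spinRep ((weylLift w)⁻¹ * thetaRows c 0 n * sBar i) *ᵥ Pi.single ⊤ 1) ⊤ := by
    rw [spinCorner, Matrix.mulVec_single_one, Matrix.col_apply]
  obtain ⟨k, rfl⟩ : ∃ k, n = k + 1 := ⟨i, hi.symm⟩
  rw [hcol, mul_assoc, spinRep_mul_mulVec, hw.spinRep_weylLift_inv_mulVec_top, ← minusFirst_self,
    (spinRep_thetaRows_mul_sBar hi c (by omega)).1]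

end Spin

end TypeB

theorem mainTheorem5 (n k : ℕ) (hk : 1 ≤ k) (hkn : k ≤ n)
    (w₀ : TypeB.Weyl n) (hw₀ : TypeB.IsLongest w₀) (c : ℕ → ℕ → ℂˣ) :
    (k < n →
      TypeB.genMinor (TypeB.fundWeight ⟨k - 1, by omega⟩) w₀ (TypeB.simpleRefl ⟨k - 1, by omega⟩)
          (TypeB.thetaMinus (TypeB.wordZero n c)) =
        (c k 1 : ℂ) + ∑ j ∈ Finset.Icc 2 (n - 1), (c k j : ℂ) / (c (k + 1) (j - 1) : ℂ)
          + (c k n : ℂ) ^ 2 / (c (k + 1) (n - 1) : ℂ)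
          + 2 * ((c k n : ℂ) / (c (k + 1) n : ℂ))
          + (c (k + 1) (n - 1) : ℂ) / (c (k + 1) n : ℂ) ^ 2
          + ∑ m ∈ Finset.Icc (k + 2) n, (c m (n + k - m) : ℂ) / (c m (n + k - m + 1) : ℂ)) ∧
    (k = n →
      TypeB.genMinor (TypeB.fundWeight ⟨k - 1, by omega⟩) w₀ (TypeB.simpleRefl ⟨k - 1, by omega⟩)
          (TypeB.thetaMinus (TypeB.wordZero n c)) = (c n n : ℂ)) := by
  constructor
  · intro hlt
    have hi : (⟨k - 1, by omega⟩ : Fin n).val + 1 < n := by simp only; omega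
    rw [TypeB.genMinor, (TypeB.isPrincipalMinor_leadingMinor hi).principalMinor_eq,
      TypeB.thetaMinus_wordZero, TypeB.weylLift_simpleRefl,
      hw₀.leadingMinor_thetaRows_eq c hi (Nat.sub_add_cancel hk).symm]
  · rintro rfl
    have hi : (⟨k - 1, by omega⟩ : Fin k).val + 1 = k := Nat.sub_add_cancel hk
    rw [TypeB.genMinor, (TypeB.isPrincipalMinor_spinCorner hi).principalMinor_eq,
      TypeB.thetaMinus_wordZero, TypeB.weylLift_simpleRefl, hw₀.spinCorner_thetaRows hi c]
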